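/- Functions on $(0,\infty)$ are Lebesgue measurable with values in $[-\infty,\infty]$, and functions that agree almost everywhere are identified. For such $f$ let $f^*(t)=\inf\{\lambda\in(0,\infty):|\{s\in(0,\infty):|f(s)|>\lambda\}|\le t\}$, $t\in(0,\infty)$ (with $\inf\emptyset=\infty$), be its nonincreasing rearrangement. For $p,q\in[1,\infty]$ and $\mathbb A=[\alpha_0,\alpha_\infty]\in\mathbb R^2$ put $$\varrho_{p,q;\mathbb A}(f)=\bigl\|t^{\frac1p-\frac1q}\,\ell^{\mathbb A}(t)\,f^*(t)\bigr\|_{L^q(0,\infty)},\qquad \ell^{\mathbb A}(t)=\begin{cases}(1-\log t)^{\alpha_0},&t\in(0,1),\\(1+\log t)^{\alpha_\infty},&t\in[1,\infty),\end{cases}$$ with the convention $\frac1\infty=0$. Let $X=L^{p,q;\mathbb A}(0,\infty)$ be the Lorentz–Zygmund space of all $f$ with $\varrho_{p,q;\mathbb A}(|f|)<\infty$. Its associate space $X'$ consists of all $g$ with $$\|g\|_{X'}=\sup\Bigl\{\int_0^\infty f(t)|g(t)|\,dt:\ f\ge0 \text{ measurable},\ \varrho_{p,q;\mathbb A}(f)\le1\Bigr\}<\infty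 .$$ **Proposition.** Let $p,q\in[1,\infty]$ and $\mathbb A=[\alpha_0,\alpha_\infty]\in\mathbb R^2$ satisfy one of the following conditions: * $p=q=1$, $\alpha_0\ge0$ and $\alpha_\infty\le0$; * $p\in(1,\infty)$; * $p=\infty$, $q\in[1,\infty)$ and $\alpha_0+\frac1q<0$; * $p=q=\infty$ and $\alpha_0\le0$. Let $\alpha\in(0,1)$ and $$T_\alpha f(t)=t^{-\alpha}\sup_{t\le s<\infty}s^{\alpha}f^*(s),\qquad t\in(0,\infty).$$ Then $T_\alpha$ is bounded on $X'$, that is, $T_\alpha$ maps $X'$ into $X'$ and there is a constant $C<\infty$ such that $\|T_\alpha f\|_{X'}\le C\|f\|_{X'}$ for all $f\in X'$, if and only if $$\text{either}\quad p=\frac1{1-\alpha},\ q=1,\ \alpha_0\ge0\ \text{ and }\ \alpha_\infty\le0,\qquad\text{or}\quad p\in\Bigl(\frac1{1-\alpha},\infty\Bigr].$$ -/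

import Mathlib

open MeasureTheory Set
open scoped ENNReal NNReal

noncomputable section

namespace LorentzZygmund

variable {R : Type*} [MeasurableSpace R]

/-- The nonincreasing rearrangement `f^*(t) = inf {lam ∈ (0,∞) : μ {|f| > lam} ≤ t}` of a
nonnegative function `f` (for a function with values in `[-∞,∞]`, apply it to `|f|`). The
infimum of the empty set is `∞`. Only the values at `t ∈ (0,∞)` matter. -/
def rearrangement (μ : Measure R) (f : R → ℝ≥0∞) (t : ℝ) : ℝ≥0∞ :=
  sInf {lam : ℝ≥0∞ | 0 < lam ∧ lam < ∞ ∧ μ {x | lam < f x} ≤ ENNReal.ofReal t}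

/-- The associate functional
`ρ'(g) = sup {∫ f g dμ : f nonnegative measurable, ρ(f) ≤ 1}` of a functional `ρ` on nonnegative
measurable functions. -/
def associate (μ : Measure R) (ρ : (R → ℝ≥0∞) → ℝ≥0∞) (g : R → ℝ≥0∞) : ℝ≥0∞ :=
  ⨆ (f : R → ℝ≥0∞) (_ : AEMeasurable f μ) (_ : ρ f ≤ 1), ∫⁻ x, f x * g x ∂μ

/-- The pointwise absolute value of a function with values in `[-∞,∞]`. -/
def absFun (f : R → EReal) : R → ℝ≥0∞ := fun x => (f x).abs

/-- The function space `{f μ-measurable with values in [-∞,∞] : ρ(|f|) < ∞}` determined by a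
functional `ρ`. -/
def space (μ : Measure R) (ρ : (R → ℝ≥0∞) → ℝ≥0∞) : Set (R → EReal) :=
  {f | AEMeasurable f μ ∧ ρ (absFun f) < ∞}

/-- The (not necessarily linear) operator `T` is bounded on the function space determined by `ρ`:
it maps the space into itself and `‖T f‖ ≤ C ‖f‖` with a finite constant `C` independent
of `f`. -/
def BoundedOn (μ : Measure R) (ρ : (R → ℝ≥0∞) → ℝ≥0∞)
    (T : (R → EReal) → (R → EReal)) : Prop :=
  ∃ C : ℝ≥0, ∀ f ∈ space μ ρ,
    T f ∈ space μ ρ ∧ ρ (absFun (T f)) ≤ (C : ℝ≥0∞) * ρ (absFun f)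

/-- The Lebesgue measure on `(0,∞)`, as a measure on the real line. Functions on `(0,∞)` are
represented by functions on the line, whose values outside `(0,∞)` are irrelevant. -/
def halfLine : Measure ℝ := volume.restrict (Ioi 0)

/-- The broken logarithmic function: `(1 - log t)^a₀` on `(0,1)` and `(1 + log t)^a₁`
on `[1,∞)`. Here `a₁` is the exponent at infinity. -/
def brokenLog (a₀ a₁ t : ℝ) : ℝ :=
  if t < 1 then (1 - Real.log t) ^ a₀ else (1 + Real.log t) ^ a₁

/-- The Lorentz-Zygmund functional `‖ t^(1/p - 1/q) ℓ^A(t) f^*(t) ‖_{L^q(0,∞)}`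
with `A = [a₀, a₁]`, on nonnegative functions on `(0,∞)`, with `1/∞ = 0`. -/
def lzNorm (p q : ℝ≥0∞) (a₀ a₁ : ℝ) (f : ℝ → ℝ≥0∞) : ℝ≥0∞ :=
  eLpNorm (fun t : ℝ =>
    ENNReal.ofReal (t ^ ((p⁻¹).toReal - (q⁻¹).toReal) * brokenLog a₀ a₁ t)
      * rearrangement halfLine f t) q halfLine

/-- The conditions on the parameters under which the Lorentz-Zygmund functional is equivalent to
a rearrangement-invariant norm. -/
def Admissible (p q : ℝ≥0∞) (a₀ a₁ : ℝ) : Prop :=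
  (p = 1 ∧ q = 1 ∧ 0 ≤ a₀ ∧ a₁ ≤ 0) ∨
  (1 < p ∧ p < ∞) ∨
  (p = ∞ ∧ 1 ≤ q ∧ q < ∞ ∧ a₀ + (q⁻¹).toReal < 0) ∨
  (p = ∞ ∧ q = ∞ ∧ a₀ ≤ 0)

/-- The operator `T_α f(t) = t^(-α) sup_{t ≤ s < ∞} s^α f^*(s)`, for `f` measurable on `(0,∞)` and
`t ∈ (0,∞)`. Its values lie in `[0,∞]`. -/
def supOperator (α : ℝ) (f : ℝ → EReal) : ℝ → EReal := fun t =>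
  ((ENNReal.ofReal (t ^ (-α)) *
    ⨆ s ∈ Ici t, ENNReal.ofReal (s ^ α) * rearrangement halfLine (absFun f) s : ℝ≥0∞) : EReal)

end LorentzZygmund

end

/-! Write θ = 1/p, b for the broken logarithm, w(t) = t^(θ-1/q) b(t) for the weight, and A for the
associate norm of g. Everything is reduced to integrals of nonincreasing functions. Since T_α g is
nonincreasing, the Hardy-Littlewood inequality replaces a test function f by f*. Conversely,
`lintegral_rearrangement_mul_le_associate` bounds ∫ g* h by 12 A for every nonincreasing h that is
normalized after dilation by 2. Its extremal function is built by hand on dyadic-type sets, so the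
triangle inequality for the Lorentz-Zygmund functional is never needed.

Sufficiency. If θ < 1 - α, then T_α g(t) is at most a constant times the sum over k ≥ 0 of 2^(kα)
g*(2^k t). Pairing the k-th term with f* and moving the dilation onto f* costs 2^(k(α-1+θ+ε)), a
convergent geometric series (`exists_associate_supFun_le_of_lt`). If θ = 1 - α, q = 1 and b is
nonincreasing, testing g* on (0,s) gives s^α g*(s) ≤ C b(s) A. Hence T_α g(t) ≤ C A t^(-α) b(t), and
this majorant is exactly A times the weight that defines the functional
(`exists_associate_supFun_le_of_eq`).

Necessity. Apply T_α to the characteristic function of (0,2N): the image is at least (N/t)^α on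
(0,N), so boundedness limits the integral of h(t) t^(-α) over (0,N) for every nonincreasing h
(`exists_lintegral_le_of_boundedOn`). For θ > 1 - α, the choices h = t^(α-1+δ) on (0,1) violate this
as δ → 0. For θ = 1 - α, characteristic functions h of (0,a) force b(N) ≤ C b(a) whenever a ≤ N,
hence the signs of the exponents. Truncated powers t^(α-1) give m ≤ C(1 + m^(1/q)) for all large m,
hence q = 1. -/

noncomputable section

namespace LorentzZygmund

/-! ### Rearrangements, associate functionals and the layer cake formula -/

section Rearrangement

variable {R : Type*} [MeasurableSpace R] {μ : Measure R}

/-- Along levels decreasing to the infimum the superlevel sets increase, so continuity of the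
measure from below carries the defining bound to the infimum itself. The levels 0 and ∞, excluded in
the definition, are admitted for c. -/
lemma rearrangement_le_iff (f : R → ℝ≥0∞) (t : ℝ) (c : ℝ≥0∞) :
    rearrangement μ f t ≤ c ↔ μ {x | c < f x} ≤ ENNReal.ofReal t := by
  constructor
  · intro h
    rcases eq_or_ne c ∞ with rfl | hc
    · simp
    have hne : {lam : ℝ≥0∞ | 0 < lam ∧ lam < ∞ ∧ μ {x | lam < f x} ≤ ENNReal.ofReal t}.Nonempty := by
      by_contra hcon
      rw [not_nonempty_iff_eq_empty] at hcon
      rw [rearrangement, hcon, sInf_empty, top_le_iff] at h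
      exact hc h
    obtain ⟨u, hu, hlim, hmem⟩ := exists_seq_tendsto_sInf hne (OrderBot.bddBelow _)
    have hsub : {x | c < f x} ⊆ ⋃ n, {x | u n < f x} := by
      intro x hx
      have hx' : sInf {lam : ℝ≥0∞ | 0 < lam ∧ lam < ∞ ∧ μ {x | lam < f x} ≤ ENNReal.ofReal t}
          < f x := lt_of_le_of_lt h hx
      obtain ⟨n, hn⟩ := (hlim.eventually (gt_mem_nhds hx')).exists
      exact mem_iUnion.2 ⟨n, hn⟩
    have hmono : Monotone fun n => {x | u n < f x} :=
      fun m n hmn x hx => lt_of_le_of_lt (hu hmn) hx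
    calc μ {x | c < f x} ≤ μ (⋃ n, {x | u n < f x}) := measure_mono hsub
      _ = ⨆ n, μ {x | u n < f x} := hmono.measure_iUnion
      _ ≤ ENNReal.ofReal t := iSup_le fun n => (hmem n).2.2
  · intro h
    refine le_of_forall_gt fun b hb => ?_
    obtain ⟨d, hcd, hdb⟩ := exists_between hb
    refine lt_of_le_of_lt (sInf_le ⟨(zero_le).trans_lt hcd, hdb.trans_le le_top, ?_⟩) hdb
    exact (measure_mono fun x hx => hcd.trans hx).trans h

lemma lt_rearrangement_iff (f : R → ℝ≥0∞) (t : ℝ) (c : ℝ≥0∞) :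
    c < rearrangement μ f t ↔ ENNReal.ofReal t < μ {x | c < f x} := by
  rw [← not_le, rearrangement_le_iff, not_le]

lemma rearrangement_antitone (f : R → ℝ≥0∞) : Antitone (rearrangement μ f) := by
  intro s t hst
  rw [rearrangement_le_iff]
  exact ((rearrangement_le_iff f s _).1 le_rfl).trans (ENNReal.ofReal_le_ofReal hst)

lemma measurable_rearrangement (f : R → ℝ≥0∞) : Measurable (rearrangement μ f) :=
  (rearrangement_antitone f).measurable

lemma rearrangement_congr_ae {f g : R → ℝ≥0∞} (h : f =ᵐ[μ] g) :
    rearrangement μ f = rearrangement μ g := by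
  funext t
  refine eq_of_forall_ge_iff fun c => ?_
  rw [rearrangement_le_iff, rearrangement_le_iff]
  have : μ {x | c < f x} = μ {x | c < g x} := by
    apply measure_congr
    filter_upwards [h] with x hx
    exact congrArg (fun y => c < y) hx
  rw [this]

lemma associate_congr_ae (ρ : (R → ℝ≥0∞) → ℝ≥0∞) {f g : R → ℝ≥0∞} (h : f =ᵐ[μ] g) :
    associate μ ρ f = associate μ ρ g := by
  unfold associate
  refine iSup_congr fun u => iSup_congr fun _ => iSup_congr fun _ => lintegral_congr_ae ?_
  filter_upwards [h] with x hx
  rw [hx]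

lemma lintegral_mul_le_associate (ρ : (R → ℝ≥0∞) → ℝ≥0∞) {f : R → ℝ≥0∞} (g : R → ℝ≥0∞)
    (hf : AEMeasurable f μ) (hρ : ρ f ≤ 1) : ∫⁻ x, f x * g x ∂μ ≤ associate μ ρ g :=
  le_iSup₂_of_le f hf (le_iSup_of_le hρ le_rfl)

lemma lintegral_superlevel_const (a : ℝ≥0∞) :
    ∫⁻ lam in Ioi (0 : ℝ), {l : ℝ | ENNReal.ofReal l < a}.indicator 1 lam = a := by
  have hm : MeasurableSet {l : ℝ | ENNReal.ofReal l < a} :=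
    measurableSet_lt ENNReal.measurable_ofReal measurable_const
  rw [lintegral_indicator_one hm, Measure.restrict_apply hm]
  rcases eq_or_ne a ∞ with rfl | ha
  · simp
  · have : {l : ℝ | ENNReal.ofReal l < a} ∩ Ioi 0 = Ioo 0 a.toReal := by
      ext l
      simp only [mem_inter_iff, mem_ofPred_eq, mem_Ioi, mem_Ioo]
      rw [and_comm]
      refine and_congr_right fun hl => ?_
      rw [ENNReal.ofReal_lt_iff_lt_toReal hl.le ha]
    rw [this, Real.volume_Ioo, sub_zero, ENNReal.ofReal_toReal ha]

/-- The layer cake formula for the integral of a product. -/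
lemma lintegral_mul_eq_lintegral_superlevel [SFinite μ] {F G : R → ℝ≥0∞} (hF : Measurable F)
    (hG : Measurable G) :
    ∫⁻ x, F x * G x ∂μ =
      ∫⁻ lam in Ioi (0 : ℝ), ∫⁻ x in {x | ENNReal.ofReal lam < F x}, G x ∂μ := by
  have hset : MeasurableSet {z : R × ℝ | ENNReal.ofReal z.2 < F z.1} :=
    measurableSet_lt (ENNReal.measurable_ofReal.comp measurable_snd) (hF.comp measurable_fst)
  calc ∫⁻ x, F x * G x ∂μ
      = ∫⁻ x, (∫⁻ lam in Ioi (0 : ℝ),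
          {z : R × ℝ | ENNReal.ofReal z.2 < F z.1}.indicator (fun z => G z.1) (x, lam)) ∂μ := by
        refine lintegral_congr fun x => ?_
        have hm : MeasurableSet {l : ℝ | ENNReal.ofReal l < F x} :=
          measurableSet_lt ENNReal.measurable_ofReal measurable_const
        conv_lhs => rw [← lintegral_superlevel_const (F x)]
        rw [← lintegral_mul_const _ (measurable_one.indicator hm)]
        refine lintegral_congr fun l => ?_
        by_cases hl : ENNReal.ofReal l < F x <;> simp [indicator, hl]
    _ = ∫⁻ lam in Ioi (0 : ℝ), ∫⁻ x,
          {z : R × ℝ | ENNReal.ofReal z.2 < F z.1}.indicator (fun z => G z.1) (x, lam) ∂μ :=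
        lintegral_lintegral_swap
          (f := fun x lam =>
            {z : R × ℝ | ENNReal.ofReal z.2 < F z.1}.indicator (fun z => G z.1) (x, lam))
          ((hG.comp measurable_fst).indicator hset).aemeasurable
    _ = _ := by
        refine lintegral_congr fun l => ?_
        rw [← lintegral_indicator (measurableSet_lt measurable_const hF)]
        refine lintegral_congr fun x => ?_
        by_cases hl : ENNReal.ofReal l < F x <;> simp [indicator, hl]

end Rearrangement

/-! ### The Hardy-Littlewood inequality on the half-line -/

lemma halfLine_Ioo {a : ℝ} : halfLine (Ioo 0 a) = ENNReal.ofReal a := by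
  rw [halfLine, Measure.restrict_apply measurableSet_Ioo,
    inter_eq_left.2 fun x hx => hx.1, Real.volume_Ioo, sub_zero]

lemma ae_halfLine_pos : ∀ᵐ t ∂halfLine, 0 < t := ae_restrict_mem measurableSet_Ioi

/-- On the half-line, an initial segment is contained in or contains `(0, m)` up to null sets. -/
lemma halfLine_inter_le {A H S : Set ℝ} (hH : ∀ s t, 0 < s → s ≤ t → t ∈ H → s ∈ H)
    (hS : ∀ t, 0 < t → ENNReal.ofReal t < halfLine A → t ∈ S) :
    halfLine (A ∩ H) ≤ halfLine (S ∩ H) := by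
  by_cases hsub : ∀ t, 0 < t → t ∈ H → ENNReal.ofReal t < halfLine A
  · calc halfLine (A ∩ H) ≤ halfLine H := measure_mono inter_subset_right
      _ ≤ halfLine (S ∩ H) := by
        apply measure_mono_ae
        filter_upwards [ae_halfLine_pos] with t ht
        exact fun htH => ⟨hS t ht (hsub t ht htH), htH⟩
  · push Not at hsub
    obtain ⟨t, ht, htH, hAt⟩ := hsub
    have hfin : halfLine A ≠ ∞ := ne_top_of_le_ne_top ENNReal.ofReal_ne_top hAt
    calc halfLine (A ∩ H) ≤ halfLine A := measure_mono inter_subset_left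
      _ = halfLine (Ioo 0 (halfLine A).toReal) := by rw [halfLine_Ioo, ENNReal.ofReal_toReal hfin]
      _ ≤ halfLine (S ∩ H) := by
        refine measure_mono fun s hs => ?_
        have hsA : ENNReal.ofReal s < halfLine A := by
          rw [ENNReal.ofReal_lt_iff_lt_toReal hs.1.le hfin]; exact hs.2
        refine ⟨hS s hs.1 hsA, hH s t hs.1 ?_ htH⟩
        have := hsA.trans_le hAt
        exact ((ENNReal.ofReal_lt_ofReal_iff ht).1 this).le

/-- The Hardy-Littlewood inequality against a nonincreasing function. -/
lemma lintegral_mul_le_lintegral_rearrangement_mul {f h : ℝ → ℝ≥0∞} (hf : AEMeasurable f halfLine)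
    (hh : Measurable h) (hanti : AntitoneOn h (Ioi 0)) :
    ∫⁻ t, f t * h t ∂halfLine ≤ ∫⁻ t, rearrangement halfLine f t * h t ∂halfLine := by
  have hfm := hf.measurable_mk
  rw [rearrangement_congr_ae hf.ae_eq_mk]
  have : ∫⁻ t, f t * h t ∂halfLine = ∫⁻ t, hf.mk f t * h t ∂halfLine := by
    apply lintegral_congr_ae
    filter_upwards [hf.ae_eq_mk] with x hx
    rw [hx]
  rw [this]
  set F := hf.mk f
  have : SFinite halfLine := by unfold halfLine; infer_instance
  rw [lintegral_mul_eq_lintegral_superlevel hfm hh,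
    lintegral_mul_eq_lintegral_superlevel (measurable_rearrangement F) hh]
  refine lintegral_mono fun lam => ?_
  -- A second layer cake, now in h, leaves only measures of A intersected with superlevel sets of h.
  -- These are initial segments of the half-line, because h is nonincreasing there.
  have key : ∀ A : Set ℝ, ∫⁻ x in A, h x ∂halfLine =
      ∫⁻ κ in Ioi (0 : ℝ), halfLine (A ∩ {x | ENNReal.ofReal κ < h x}) := by
    intro A
    have := lintegral_mul_eq_lintegral_superlevel (μ := halfLine.restrict A) hh
      (measurable_const (a := (1 : ℝ≥0∞)))
    simp only [mul_one, lintegral_const, one_mul] at this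
    rw [this]
    refine lintegral_congr fun κ => ?_
    rw [Measure.restrict_apply MeasurableSet.univ, univ_inter,
      Measure.restrict_apply (measurableSet_lt measurable_const hh), inter_comm]
  rw [key, key]
  refine lintegral_mono fun κ => ?_
  refine halfLine_inter_le ?_ ?_
  · intro s t hs hst ht
    exact lt_of_lt_of_le ht (hanti hs (hs.trans_le hst) hst)
  · intro t _ hlt
    exact (lt_rearrangement_iff F t _).2 hlt

lemma rearrangement_le_self {h : ℝ → ℝ≥0∞} (hanti : AntitoneOn h (Ioi 0)) {t : ℝ} (ht : 0 < t) :
    rearrangement halfLine h t ≤ h t := by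
  rw [rearrangement_le_iff, ← halfLine_Ioo]
  apply measure_mono_ae
  filter_upwards [ae_halfLine_pos] with s hs hlt
  refine ⟨hs, ?_⟩
  by_contra hcon
  exact absurd (hanti ht hs (not_lt.1 hcon)) (not_le.2 hlt)

/-! ### A converse to the Hardy-Littlewood inequality -/

/-- The measure of the part of S to the left of x is a 1-Lipschitz function of x, so the
intermediate value theorem applies. -/
lemma exists_measurableSet_subset_halfLine_eq {S : Set ℝ} (hS : MeasurableSet S) {r : ℝ}
    (hr : 0 ≤ r) (hlt : ENNReal.ofReal r < halfLine S) :
    ∃ E ⊆ S, MeasurableSet E ∧ halfLine E = ENNReal.ofReal r := by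
  have hfin : ∀ x : ℝ, halfLine (S ∩ Iio x) ≠ ∞ := by
    intro x
    refine ne_top_of_le_ne_top (b := ENNReal.ofReal x) ENNReal.ofReal_ne_top ?_
    rw [← halfLine_Ioo]
    apply measure_mono_ae
    filter_upwards [ae_halfLine_pos] with s hs hlt
    exact ⟨hs, hlt.2⟩
  have hlip : LipschitzWith 1 fun x : ℝ => (halfLine (S ∩ Iio x)).toReal := by
    apply LipschitzWith.of_le_add
    intro x y
    have : halfLine (S ∩ Iio x) ≤ halfLine (S ∩ Iio y) + ENNReal.ofReal (dist x y) := by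
      calc halfLine (S ∩ Iio x) ≤ halfLine ((S ∩ Iio y) ∪ Ico y x) := by
            refine measure_mono fun s hs => ?_
            rcases lt_or_ge s y with h | h
            · exact Or.inl ⟨hs.1, h⟩
            · exact Or.inr ⟨h, hs.2⟩
        _ ≤ halfLine (S ∩ Iio y) + halfLine (Ico y x) := measure_union_le _ _
        _ ≤ _ := by
            gcongr
            calc halfLine (Ico y x) ≤ volume (Ico y x) := Measure.restrict_apply_le _ _
              _ = ENNReal.ofReal (x - y) := Real.volume_Ico
              _ ≤ _ := ENNReal.ofReal_le_ofReal (le_abs_self _)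
    rw [← ENNReal.toReal_ofReal (dist_nonneg (x := x) (y := y)),
      ← ENNReal.toReal_add (hfin y) ENNReal.ofReal_ne_top]
    exact ENNReal.toReal_mono (ENNReal.add_ne_top.2 ⟨hfin y, ENNReal.ofReal_ne_top⟩) this
  have hsup : halfLine S = ⨆ n : ℕ, halfLine (S ∩ Iio (n : ℝ)) := by
    have hmono : Monotone fun n : ℕ => S ∩ Iio (n : ℝ) := fun m n hmn x hx =>
      ⟨hx.1, lt_of_lt_of_le (mem_Iio.1 hx.2) (Nat.cast_le.2 hmn)⟩
    rw [← hmono.measure_iUnion, ← inter_iUnion]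
    congr 1
    refine (inter_eq_left.2 fun x _ => ?_).symm
    obtain ⟨n, hn⟩ := exists_nat_gt x
    exact mem_iUnion.2 ⟨n, hn⟩
  rw [hsup] at hlt
  obtain ⟨n, hn⟩ := lt_iSup_iff.1 hlt
  have h0 : (halfLine (S ∩ Iio (0 : ℝ))).toReal = 0 := by
    have : halfLine (S ∩ Iio (0 : ℝ)) = 0 := by
      refine measure_mono_null inter_subset_right ?_
      rw [halfLine, Measure.restrict_apply measurableSet_Iio]
      convert measure_empty (μ := (volume : Measure ℝ))
      ext x; simp only [mem_inter_iff, mem_Iio, mem_Ioi, mem_empty_iff_false, iff_false]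
      exact fun h => lt_asymm h.1 h.2
    rw [this]; rfl
  have hivt := intermediate_value_Icc (Nat.cast_nonneg n : (0 : ℝ) ≤ n) hlip.continuous.continuousOn
  obtain ⟨x, _, hx⟩ := hivt ⟨by simp only [h0]; exact hr,
    (ENNReal.ofReal_le_iff_le_toReal (hfin _)).1 hn.le⟩
  refine ⟨S ∩ Iio x, inter_subset_left, hS.inter measurableSet_Iio, ?_⟩
  rw [← hx, ENNReal.ofReal_toReal (hfin x)]

lemma measure_iUnion_geometric_le {E : ℤ → Set ℝ}
    (hE : ∀ k, halfLine (E k) = ENNReal.ofReal (4 ^ k)) (k : ℤ) :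
    halfLine (⋃ n : ℕ, E (k - n)) ≤ 2 * ENNReal.ofReal (4 ^ k) := by
  calc halfLine (⋃ n : ℕ, E (k - n)) ≤ ∑' n : ℕ, halfLine (E (k - n)) := measure_iUnion_le _
    _ ≤ ∑' n : ℕ, ENNReal.ofReal (4 ^ k) * (2 : ℝ≥0∞)⁻¹ ^ n := by
        refine ENNReal.tsum_le_tsum fun n => ?_
        have h2 : (2 : ℝ≥0∞)⁻¹ ^ n = ENNReal.ofReal ((2⁻¹ : ℝ) ^ n) := by
          rw [ENNReal.ofReal_pow (by positivity), ENNReal.ofReal_inv_of_pos two_pos]; simp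
        rw [hE, h2, ← ENNReal.ofReal_mul (by positivity)]
        apply ENNReal.ofReal_le_ofReal
        rw [zpow_sub₀ (by norm_num), div_eq_mul_inv, zpow_natCast, ← inv_pow]
        gcongr
        norm_num
    _ = 2 * ENNReal.ofReal (4 ^ k) := by
        rw [ENNReal.tsum_mul_left, ENNReal.tsum_geometric, ENNReal.one_sub_inv_two, inv_inv,
          mul_comm]

/-- A function that is almost extremal in the Hardy-Littlewood inequality for `g`, and whose
rearrangement is controlled by the prescribed nonincreasing function `h`. -/
lemma exists_lintegral_rearrangement_mul_le {g h : ℝ → ℝ≥0∞} (hg : Measurable g)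
    (hanti : AntitoneOn h (Ioi 0)) {M : ℝ≥0∞} (hM : M ≠ ∞) :
    ∃ f : ℝ → ℝ≥0∞, Measurable f ∧ (∀ t, 0 < t → rearrangement halfLine f t ≤ h (t / 2)) ∧
      ∫⁻ t, min (rearrangement halfLine g t) M * h t ∂halfLine ≤
        12 * ∫⁻ t, f t * g t ∂halfLine := by
  have h4 : ∀ k : ℤ, (0 : ℝ) < 4 ^ k := fun k => by positivity
  -- Truncating at M keeps the level finite, so halving puts it strictly below g*(4^k) unless it is
  -- 0. Either way its superlevel set has measure above 4^k.
  set m : ℤ → ℝ≥0∞ := fun k => min (rearrangement halfLine g (4 ^ k)) M / 2 with hm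
  have hlev : ∀ k, ENNReal.ofReal (4 ^ k) < halfLine {x | m k ≤ g x} := by
    intro k
    rcases eq_or_ne (min (rearrangement halfLine g (4 ^ k)) M) 0 with h0 | h0
    · have : m k = 0 := by simp only [hm, h0, ENNReal.zero_div]
      rw [this]
      have huniv : {x | 0 ≤ g x} = univ := by ext x; simp
      rw [huniv, halfLine, Measure.restrict_apply_univ, Real.volume_Ioi]
      exact ENNReal.ofReal_lt_top
    · have hlt : m k < rearrangement halfLine g (4 ^ k) :=
        (ENNReal.half_lt_self h0 (ne_top_of_le_ne_top hM (min_le_right _ _))).trans_le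
          (min_le_left _ _)
      exact ((lt_rearrangement_iff _ _ _).1 hlt).trans_le (measure_mono fun x (hx : m k < g x) => (hx.le : m k ≤ g x))
  choose E hEsub hEm hE using fun k =>
    exists_measurableSet_subset_halfLine_eq (measurableSet_le measurable_const hg) (h4 k).le (hlev k)
  have htail := measure_iUnion_geometric_le hE
  set f : ℝ → ℝ≥0∞ := fun x => ⨆ k, (E k).indicator (fun _ => h (4 ^ k)) x with hf
  have hfm : Measurable f := .iSup fun k => measurable_const.indicator (hEm k)
  refine ⟨f, hfm, ?_, ?_⟩
  · intro t ht
    -- With 4^K < t/2 ≤ 4^(K+1), only the sets E k with k ≤ K can carry values above h(t/2), and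
    -- together they have measure at most 2 · 4^K < t. This is the source of the dilation by 2.
    obtain ⟨K, hK1, hK2⟩ := exists_mem_Ioc_zpow (half_pos ht) (by norm_num : (1 : ℝ) < 4)
    rw [rearrangement_le_iff]
    calc halfLine {x | h (t / 2) < f x} ≤ halfLine (⋃ n : ℕ, E (K - n)) := by
          refine measure_mono fun x hx => ?_
          obtain ⟨k, hk⟩ := lt_iSup_iff.1 (show h (t / 2) < f x from hx)
          have hxE : x ∈ E k := by
            by_contra hcon
            simp [hcon] at hk
          rw [indicator_of_mem hxE] at hk
          have hkt : (4 : ℝ) ^ k < t / 2 := by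
            by_contra hcon
            exact absurd (hanti (half_pos ht) (h4 k) (not_lt.1 hcon)) (not_le.2 hk)
          have hkK : k ≤ K := by
            have := (zpow_lt_zpow_iff_right₀ (by norm_num : (1 : ℝ) < 4)).1 (hkt.trans_le hK2)
            omega
          refine mem_iUnion.2 ⟨(K - k).toNat, ?_⟩
          rw [Int.toNat_of_nonneg (by omega)]
          simpa using hxE
      _ ≤ 2 * ENNReal.ofReal (4 ^ K) := htail K
      _ = ENNReal.ofReal (2 * 4 ^ K) := by rw [ENNReal.ofReal_mul two_pos.le]; simp
      _ ≤ ENNReal.ofReal t := ENNReal.ofReal_le_ofReal (by linarith)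
  -- The sets of smaller index have total measure at most 2 · 4^(k-1), half that of E k. So F k
  -- keeps at least half of E k, and the F k are disjoint.
  · set F : ℤ → Set ℝ := fun k => E k \ ⋃ n : ℕ, E (k - 1 - n) with hF
    have hFm : ∀ k, MeasurableSet (F k) := fun k => (hEm k).diff (.iUnion fun n => hEm _)
    have hFd : Pairwise (Function.onFun Disjoint F) := by
      have : ∀ i j, i < j → Disjoint (F i) (F j) := by
        intro i j hij
        rw [Set.disjoint_left]
        intro x hxi hxj
        refine hxj.2 (mem_iUnion.2 ⟨(j - 1 - i).toNat, ?_⟩)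
        rw [Int.toNat_of_nonneg (by omega)]
        simpa using hxi.1
      intro i j hij
      rcases lt_or_gt_of_ne hij with h | h
      · exact this i j h
      · exact (this j i h).symm
    have hFmeas : ∀ k, ENNReal.ofReal (4 ^ k) ≤ 2 * halfLine (F k) := by
      intro k
      have h1 : ENNReal.ofReal (4 ^ k) ≤ halfLine (F k) + ENNReal.ofReal (4 ^ k / 2) := by
        calc ENNReal.ofReal (4 ^ k) = halfLine (E k) := (hE k).symm
          _ ≤ halfLine (F k ∪ ⋃ n : ℕ, E (k - 1 - n)) :=
              measure_mono fun x hx => by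
                by_cases hU : x ∈ ⋃ n : ℕ, E (k - 1 - n)
                · exact Or.inr hU
                · exact Or.inl ⟨hx, hU⟩
          _ ≤ halfLine (F k) + halfLine (⋃ n : ℕ, E (k - 1 - n)) := measure_union_le _ _
          _ ≤ _ := by
              gcongr
              refine (htail (k - 1)).trans (le_of_eq ?_)
              rw [zpow_sub_one₀ (by norm_num), show (4 : ℝ) ^ k / 2 = 2 * (4 ^ k * 4⁻¹) by ring,
                ENNReal.ofReal_mul two_pos.le]
              simp
      have h2 : ENNReal.ofReal (4 ^ k / 2) ≤ halfLine (F k) := by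
        have h3 : ENNReal.ofReal (4 ^ k) = ENNReal.ofReal (4 ^ k / 2) + ENNReal.ofReal (4 ^ k / 2) := by
          rw [← ENNReal.ofReal_add (by positivity) (by positivity)]; congr 1; ring
        rw [h3] at h1
        exact (ENNReal.add_le_add_iff_right ENNReal.ofReal_ne_top).1 h1
      calc ENNReal.ofReal (4 ^ k) = 2 * ENNReal.ofReal (4 ^ k / 2) := by
            rw [← ENNReal.ofReal_ofNat 2, ← ENNReal.ofReal_mul (by norm_num)]; congr 1; ring
        _ ≤ _ := by gcongr
    have hcover : Ioi (0 : ℝ) ⊆ ⋃ k : ℤ, Ico ((4 : ℝ) ^ k) (4 ^ (k + 1)) := fun t ht =>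
      mem_iUnion.2 (exists_mem_Ico_zpow ht (by norm_num))
    -- The constant is 12 = 2 · 3 · 2: the halved level, the length 3 · 4^k of the interval, and the
    -- half of E k lost in F k.
    have hpiece : ∀ k : ℤ, ∫⁻ t in Ico ((4 : ℝ) ^ k) (4 ^ (k + 1)),
        min (rearrangement halfLine g t) M * h t ≤ 12 * ∫⁻ t in F k, f t * g t ∂halfLine := by
      intro k
      calc ∫⁻ t in Ico ((4 : ℝ) ^ k) (4 ^ (k + 1)), min (rearrangement halfLine g t) M * h t
          ≤ ∫⁻ t in Ico ((4 : ℝ) ^ k) (4 ^ (k + 1)),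
              min (rearrangement halfLine g (4 ^ k)) M * h (4 ^ k) := by
            refine setLIntegral_mono measurable_const fun t ht => ?_
            gcongr
            · exact rearrangement_antitone g ht.1
            · exact hanti (h4 k) ((h4 k).trans_le ht.1) ht.1
        _ = (2 * m k) * h (4 ^ k) * (3 * ENNReal.ofReal (4 ^ k)) := by
            rw [setLIntegral_const, Real.volume_Ico]
            congr 2
            · rw [hm, ENNReal.mul_div_cancel two_ne_zero ENNReal.ofNat_ne_top]
            · rw [← ENNReal.ofReal_ofNat 3, ← ENNReal.ofReal_mul (by norm_num)]
              congr 1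
              rw [zpow_add_one₀ (by norm_num)]; ring
        _ ≤ (2 * m k) * h (4 ^ k) * (3 * (2 * halfLine (F k))) := by
            gcongr
            exact hFmeas k
        _ = 12 * ((h (4 ^ k) * m k) * halfLine (F k)) := by ring
        _ = 12 * ∫⁻ t in F k, h (4 ^ k) * m k ∂halfLine := by rw [setLIntegral_const]
        _ ≤ _ := by
            refine mul_le_mul_right (setLIntegral_mono (hfm.mul hg) fun t ht => ?_) _
            refine mul_le_mul' ?_ ?_
            · refine le_iSup_of_le k ?_
              rw [indicator_of_mem ht.1]
            · exact hEsub k ht.1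
    calc ∫⁻ t, min (rearrangement halfLine g t) M * h t ∂halfLine
        ≤ ∫⁻ t in ⋃ k : ℤ, Ico ((4 : ℝ) ^ k) (4 ^ (k + 1)),
            min (rearrangement halfLine g t) M * h t := lintegral_mono_set hcover
      _ ≤ ∑' k : ℤ, ∫⁻ t in Ico ((4 : ℝ) ^ k) (4 ^ (k + 1)),
            min (rearrangement halfLine g t) M * h t := lintegral_iUnion_le _ _
      _ ≤ ∑' k : ℤ, 12 * ∫⁻ t in F k, f t * g t ∂halfLine := ENNReal.tsum_le_tsum hpiece
      _ = 12 * ∫⁻ t in ⋃ k, F k, f t * g t ∂halfLine := by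
          rw [ENNReal.tsum_mul_left, lintegral_iUnion hFm hFd]
      _ ≤ _ := by
          exact mul_le_mul_right (setLIntegral_le_lintegral _ _) _

/-- The weight in the Lorentz-Zygmund functional; here `θ` plays the role of `1/p`. -/
def weight (θ : ℝ) (q : ℝ≥0∞) (a₀ a₁ t : ℝ) : ℝ≥0∞ :=
  ENNReal.ofReal (t ^ (θ - (q⁻¹).toReal) * brokenLog a₀ a₁ t)

/-- The almost extremal function for g* truncated at n is admissible in the associate norm because
its rearrangement lies below h(t/2). Monotone convergence in n removes the truncation. -/
lemma lintegral_rearrangement_mul_le_associate (p q : ℝ≥0∞) (a₀ a₁ : ℝ) {g h : ℝ → ℝ≥0∞}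
    (hg : AEMeasurable g halfLine) (hh : Measurable h) (hanti : AntitoneOn h (Ioi 0))
    (hρ : eLpNorm (fun t => weight (p⁻¹).toReal q a₀ a₁ t * h (t / 2)) q halfLine ≤ 1) :
    ∫⁻ t, rearrangement halfLine g t * h t ∂halfLine ≤
      12 * associate halfLine (lzNorm p q a₀ a₁) g := by
  rw [rearrangement_congr_ae hg.ae_eq_mk, associate_congr_ae _ hg.ae_eq_mk]
  have hgm := hg.measurable_mk
  set G := hg.mk g
  have hlim : ∀ t, rearrangement halfLine G t * h t =
      ⨆ n : ℕ, min (rearrangement halfLine G t) n * h t := by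
    intro t
    rw [← ENNReal.iSup_mul]
    congr 1
    refine le_antisymm ?_ (iSup_le fun n => min_le_left _ _)
    refine le_of_forall_lt fun c hc => ?_
    obtain ⟨n, hn⟩ := ENNReal.exists_nat_gt (hc.trans_le le_top).ne
    exact lt_iSup_iff.2 ⟨n, lt_min hc hn⟩
  simp_rw [hlim]
  rw [lintegral_iSup (f := fun (n : ℕ) t => min (rearrangement halfLine G t) n * h t)
    (fun n => ((measurable_rearrangement G).min measurable_const).mul hh)
    (fun i j hij t => by dsimp only; gcongr)]
  refine iSup_le fun n => ?_
  obtain ⟨f, hf, hfh, hle⟩ := exists_lintegral_rearrangement_mul_le hgm hanti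
    (ENNReal.natCast_ne_top n)
  refine hle.trans ?_
  gcongr
  refine lintegral_mul_le_associate _ _ hf.aemeasurable (le_trans ?_ hρ)
  apply eLpNorm_mono_enorm_ae
  filter_upwards [ae_halfLine_pos] with t ht
  simp only [enorm_eq_self, weight]
  gcongr
  exact hfh t ht

/-! ### Slow variation of the broken logarithm -/

lemma rpow_le_mul_rpow {x y c : ℝ} (hx : 0 < x) (hy : 0 < y) (hc : 1 ≤ c) (hxy : x ≤ c * y)
    (hyx : y ≤ c * x) (a : ℝ) : x ^ a ≤ c ^ |a| * y ^ a := by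
  have hc0 : 0 < c := one_pos.trans_le hc
  rcases le_or_gt 0 a with ha | ha
  · rw [abs_of_nonneg ha, ← Real.mul_rpow hc0.le hy.le]
    exact Real.rpow_le_rpow hx.le hxy ha
  · rw [abs_of_neg ha, Real.rpow_neg hc0.le, ← Real.inv_rpow hc0.le,
      ← Real.mul_rpow (inv_nonneg.2 hc0.le) hy.le]
    refine Real.rpow_le_rpow_of_nonpos (by positivity) ?_ ha.le
    rw [inv_mul_le_iff₀ hc0]
    exact hyx

lemma brokenLog_eq {a₀ a₁ t : ℝ} (ht : 0 < t) :
    brokenLog a₀ a₁ t = (1 + max 0 (-Real.log t)) ^ a₀ * (1 + max 0 (Real.log t)) ^ a₁ := by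
  unfold brokenLog
  split_ifs with h
  · have := Real.log_neg ht h
    rw [max_eq_right (by linarith), max_eq_left this.le]
    simp [sub_eq_add_neg]
  · have := Real.log_nonneg (not_lt.1 h)
    rw [max_eq_left (by linarith), max_eq_right this]
    simp

lemma brokenLog_pos {a₀ a₁ t : ℝ} (ht : 0 < t) : 0 < brokenLog a₀ a₁ t := by
  rw [brokenLog_eq ht]
  have h1 := le_max_left 0 (-Real.log t)
  have h2 := le_max_left 0 (Real.log t)
  positivity

@[simp] lemma brokenLog_one (a₀ a₁ : ℝ) : brokenLog a₀ a₁ 1 = 1 := by simp [brokenLog]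

lemma measurable_brokenLog (a₀ a₁ : ℝ) : Measurable (brokenLog a₀ a₁) := by
  unfold brokenLog
  refine Measurable.ite measurableSet_Iio ?_ ?_
  · exact (measurable_const.sub Real.measurable_log).pow_const _
  · exact (measurable_const.add Real.measurable_log).pow_const _

lemma one_add_rpow_le_exp {ε N : ℝ} (hε : 0 < ε) (hN : 0 ≤ N) :
    ∃ C : ℝ, 0 < C ∧ ∀ d, 0 ≤ d → (1 + d) ^ N ≤ C * Real.exp (ε * d) := by
  set δ := min 1 (ε / (N + 1)) with hδ
  have hδ0 : 0 < δ := lt_min one_pos (by positivity)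
  have hδ1 : δ ≤ 1 := min_le_left _ _
  have hδε : δ * N ≤ ε := by
    have : δ ≤ ε / (N + 1) := min_le_right _ _
    rw [le_div_iff₀ (by positivity)] at this
    nlinarith
  refine ⟨(δ⁻¹) ^ N, by positivity, fun d hd => ?_⟩
  have h1 : 1 + d ≤ δ⁻¹ * Real.exp (δ * d) := by
    have := Real.add_one_le_exp (δ * d)
    rw [inv_mul_eq_div, le_div_iff₀ hδ0]
    nlinarith
  calc (1 + d) ^ N ≤ (δ⁻¹ * Real.exp (δ * d)) ^ N :=
        Real.rpow_le_rpow (by positivity) h1 hN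
    _ = (δ⁻¹) ^ N * Real.exp (δ * d * N) := by
        rw [Real.mul_rpow (by positivity) (Real.exp_pos _).le, ← Real.exp_mul]
    _ ≤ _ := by
        refine mul_le_mul_of_nonneg_left (Real.exp_le_exp.2 ?_) (by positivity)
        calc δ * d * N = δ * N * d := by ring
          _ ≤ ε * d := mul_le_mul_of_nonneg_right hδε hd

/-- If log t and log s differ by d, each factor 1 + max(0, ±log) changes by a ratio of at most 1 +
d, and a power of 1 + d is dominated by exp(εd). -/
lemma brokenLog_le_exp (a₀ a₁ : ℝ) {ε : ℝ} (hε : 0 < ε) :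
    ∃ C : ℝ, 0 < C ∧ ∀ s t, 0 < s → 0 < t →
      brokenLog a₀ a₁ t ≤ C * Real.exp (ε * |Real.log t - Real.log s|) * brokenLog a₀ a₁ s := by
  obtain ⟨C, hC, h⟩ := one_add_rpow_le_exp hε (N := |a₀| + |a₁|) (by positivity)
  refine ⟨C, hC, fun s t hs ht => ?_⟩
  set d := |Real.log t - Real.log s| with hd
  have hd0 : 0 ≤ d := abs_nonneg _
  have key : ∀ u v a : ℝ, |u - v| = d →
      (1 + max 0 u) ^ a ≤ (1 + d) ^ |a| * (1 + max 0 v) ^ a := by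
    intro u v a huv
    have h1 := abs_le.1 huv.le
    have hu := le_max_left 0 u
    have hv := le_max_left 0 v
    refine rpow_le_mul_rpow (by positivity) (by positivity) (by linarith) ?_ ?_ a
    · have : max 0 u ≤ max 0 v + d :=
        max_le (by positivity) (by linarith [le_max_right 0 v])
      nlinarith
    · have : max 0 v ≤ max 0 u + d :=
        max_le (by positivity) (by linarith [le_max_right 0 u])
      nlinarith
  have k0 := key (-Real.log t) (-Real.log s) a₀ (by rw [hd, ← abs_neg]; congr 1; ring)
  have k1 := key (Real.log t) (Real.log s) a₁ rfl
  rw [brokenLog_eq ht, brokenLog_eq hs]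
  calc _ ≤ ((1 + d) ^ |a₀| * (1 + max 0 (-Real.log s)) ^ a₀) *
        ((1 + d) ^ |a₁| * (1 + max 0 (Real.log s)) ^ a₁) := by gcongr
    _ = (1 + d) ^ (|a₀| + |a₁|) *
        ((1 + max 0 (-Real.log s)) ^ a₀ * (1 + max 0 (Real.log s)) ^ a₁) := by
      rw [Real.rpow_add (by positivity)]; ring
    _ ≤ _ := by
      gcongr
      exact h d hd0

lemma brokenLog_le_rpow (a₀ a₁ : ℝ) {ε : ℝ} (hε : 0 < ε) :
    ∃ C : ℝ, 0 < C ∧ ∀ s t, 0 < s → s ≤ t →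
      brokenLog a₀ a₁ t ≤ C * (t / s) ^ ε * brokenLog a₀ a₁ s ∧
      brokenLog a₀ a₁ s ≤ C * (t / s) ^ ε * brokenLog a₀ a₁ t := by
  obtain ⟨C, hC, h⟩ := brokenLog_le_exp a₀ a₁ hε
  refine ⟨C, hC, fun s t hs hst => ?_⟩
  have ht := hs.trans_le hst
  have e1 : |Real.log t - Real.log s| = Real.log (t / s) := by
    rw [Real.log_div ht.ne' hs.ne', abs_of_nonneg (sub_nonneg.2 (Real.log_le_log hs hst))]
  have e2 : Real.exp (ε * Real.log (t / s)) = (t / s) ^ ε := by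
    rw [Real.rpow_def_of_pos (div_pos ht hs), mul_comm]
  have h1 := h s t hs ht
  have h2 := h t s ht hs
  rw [abs_sub_comm] at h2
  rw [e1, e2] at h1 h2
  exact ⟨h1, h2⟩

lemma eLpNorm_le_ofReal_mul {μ : Measure ℝ} {f g : ℝ → ℝ≥0∞} {c : ℝ} (q : ℝ≥0∞)
    (h : ∀ᵐ t ∂μ, f t ≤ ENNReal.ofReal c * g t) :
    eLpNorm f q μ ≤ ENNReal.ofReal c * eLpNorm g q μ := by
  exact eLpNorm_le_nnreal_smul_eLpNorm_of_ae_le_mul' (c := c.toNNReal) (f := f) (g := g) (μ := μ)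
    h q

/-! ### Dilations -/

lemma measurableEmbedding_div {c : ℝ} (hc : 0 < c) : MeasurableEmbedding fun t : ℝ => t / c := by
  simpa [div_eq_inv_mul] using measurableEmbedding_mulLeft₀ (inv_ne_zero hc.ne')

lemma map_div_halfLine {c : ℝ} (hc : 0 < c) :
    Measure.map (fun t => t / c) halfLine = ENNReal.ofReal c • halfLine := by
  have hpre : (fun t : ℝ => t / c) ⁻¹' (Ioi 0) = Ioi 0 := by
    ext t; simp [hc, div_pos_iff_of_pos_right]
  have h := (measurableEmbedding_div hc).restrict_map volume (Ioi 0)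
  rw [hpre] at h
  have hv : Measure.map (fun t : ℝ => t / c) volume = ENNReal.ofReal c • volume := by
    have := Real.map_volume_mul_left (inv_ne_zero hc.ne')
    simpa [div_eq_inv_mul, abs_of_pos hc] using this
  rw [halfLine, ← h, hv, Measure.restrict_smul]

lemma lintegral_div_halfLine (F : ℝ → ℝ≥0∞) {c : ℝ} (hc : 0 < c) :
    ∫⁻ t, F (t / c) ∂halfLine = ENNReal.ofReal c * ∫⁻ t, F t ∂halfLine := by
  rw [← (measurableEmbedding_div hc).lintegral_map F, map_div_halfLine hc, lintegral_smul_measure,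
    smul_eq_mul]

lemma eLpNorm_div_halfLine (F : ℝ → ℝ≥0∞) (q : ℝ≥0∞) {c : ℝ} (hc : 0 < c) :
    eLpNorm (fun t => F (t / c)) q halfLine =
      ENNReal.ofReal (c ^ (q⁻¹).toReal) * eLpNorm F q halfLine := by
  have := (measurableEmbedding_div hc).eLpNorm_map_measure (g := F) (p := q) (μ := halfLine)
  rw [map_div_halfLine hc, eLpNorm_smul_measure_of_ne_zero (by simpa using hc), one_div,
    ENNReal.ofReal_rpow_of_pos hc, smul_eq_mul] at this
  exact this.symm

/-- Dilations are bounded on Lorentz-Zygmund spaces. -/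
lemma eLpNorm_weight_mul_div_le (θ : ℝ) (q : ℝ≥0∞) (a₀ a₁ : ℝ) {ε : ℝ} (hε : 0 < ε) :
    ∃ C : ℝ, 0 < C ∧ ∀ c, 1 ≤ c → ∀ h : ℝ → ℝ≥0∞,
      eLpNorm (fun t => weight θ q a₀ a₁ t * h (t / c)) q halfLine ≤
        ENNReal.ofReal (C * c ^ (θ + ε)) *
          eLpNorm (fun t => weight θ q a₀ a₁ t * h t) q halfLine := by
  obtain ⟨C, hC, hb⟩ := brokenLog_le_rpow a₀ a₁ hε
  refine ⟨C, hC, fun c hc h => ?_⟩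
  have hc0 : 0 < c := one_pos.trans_le hc
  have h1 : eLpNorm (fun t => weight θ q a₀ a₁ t * h (t / c)) q halfLine ≤
      ENNReal.ofReal (c ^ (θ - (q⁻¹).toReal) * (C * c ^ ε)) *
        eLpNorm (fun t => weight θ q a₀ a₁ (t / c) * h (t / c)) q halfLine := by
    apply eLpNorm_le_ofReal_mul
    filter_upwards [ae_halfLine_pos] with t ht
    rw [← mul_assoc]
    gcongr
    unfold weight
    rw [← ENNReal.ofReal_mul (by positivity)]
    apply ENNReal.ofReal_le_ofReal
    have htc : 0 < t / c := div_pos ht hc0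
    have := (hb (t / c) t htc (div_le_self ht.le hc)).1
    rw [div_div_cancel₀ ht.ne'] at this
    calc t ^ (θ - (q⁻¹).toReal) * brokenLog a₀ a₁ t
        ≤ t ^ (θ - (q⁻¹).toReal) * (C * c ^ ε * brokenLog a₀ a₁ (t / c)) := by gcongr
      _ = (c * (t / c)) ^ (θ - (q⁻¹).toReal) * (C * c ^ ε * brokenLog a₀ a₁ (t / c)) := by
          rw [mul_div_cancel₀ _ hc0.ne']
      _ = _ := by rw [Real.mul_rpow hc0.le htc.le]; ring
  refine h1.trans (le_of_eq ?_)
  rw [eLpNorm_div_halfLine (fun t => weight θ q a₀ a₁ t * h t) q hc0, ← mul_assoc,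
    ← ENNReal.ofReal_mul (by positivity)]
  congr 2
  rw [show θ + ε = (θ - (q⁻¹).toReal) + ε + (q⁻¹).toReal by ring, Real.rpow_add hc0,
    Real.rpow_add hc0]
  ring

/-! ### Norms of characteristic functions and the weak-type bound -/

lemma halfLine_restrict_Ioo {b a : ℝ} (hb : 0 ≤ b) :
    halfLine.restrict (Ioo b a) = volume.restrict (Ioo b a) := by
  rw [halfLine, Measure.restrict_restrict measurableSet_Ioo,
    inter_eq_left.2 fun x hx => mem_Ioi.2 (hb.trans_lt hx.1)]

lemma lintegral_Ioo_rpow {a b : ℝ} (ha : 0 ≤ a) (hb : 0 < b) :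
    ∫⁻ t in Ioo 0 a, ENNReal.ofReal (t ^ (b - 1)) ∂halfLine = ENNReal.ofReal (a ^ b / b) := by
  rw [halfLine_restrict_Ioo le_rfl, Measure.restrict_congr_set Ioo_ae_eq_Ioc,
    ← ofReal_integral_eq_lintegral_ofReal]
  · rw [← intervalIntegral.integral_of_le ha, integral_rpow (Or.inl (by linarith))]
    simp [hb.ne']
  · exact (intervalIntegrable_iff_integrableOn_Ioc_of_le ha).1
      (intervalIntegral.intervalIntegrable_rpow' (by linarith))
  · filter_upwards [ae_restrict_mem measurableSet_Ioc] with t ht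
    exact Real.rpow_nonneg ht.1.le _

lemma toReal_inv_eq (q : ℝ≥0∞) : (q⁻¹).toReal = 1 / q.toReal := by
  rw [ENNReal.toReal_inv, one_div]

lemma eLpNorm_indicator_rpow_le {q : ℝ≥0∞} (hq : 1 ≤ q) {δ : ℝ} (hδ : 0 < δ) :
    ∃ D : ℝ, 0 < D ∧ ∀ a, 0 < a →
      eLpNorm ((Ioo 0 a).indicator fun t => ENNReal.ofReal (t ^ (δ - (q⁻¹).toReal))) q halfLine ≤
        ENNReal.ofReal (D * a ^ δ) := by
  rcases eq_or_ne q ∞ with rfl | hqt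
  · refine ⟨1, one_pos, fun a ha => ?_⟩
    rw [eLpNorm_exponent_top]
    refine eLpNormEssSup_le_of_ae_enorm_bound (Filter.Eventually.of_forall fun t => ?_)
    rw [enorm_eq_self]
    by_cases h : t ∈ Ioo 0 a
    · rw [indicator_of_mem h]
      simp only [ENNReal.inv_top, ENNReal.toReal_zero, sub_zero, one_mul]
      exact ENNReal.ofReal_le_ofReal (Real.rpow_le_rpow h.1.le h.2.le hδ.le)
    · simp [h]
  · have hq0 : q ≠ 0 := (zero_lt_one.trans_le hq).ne'
    have hqr : 0 < q.toReal := ENNReal.toReal_pos hq0 hqt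
    refine ⟨(δ * q.toReal)⁻¹ ^ (1 / q.toReal), by positivity, fun a ha => ?_⟩
    rw [eLpNorm_indicator_eq_eLpNorm_restrict measurableSet_Ioo,
      eLpNorm_eq_lintegral_rpow_enorm_toReal hq0 hqt, toReal_inv_eq]
    have : ∫⁻ t in Ioo 0 a, ‖ENNReal.ofReal (t ^ (δ - 1 / q.toReal))‖ₑ ^ q.toReal ∂halfLine =
        ∫⁻ t in Ioo 0 a, ENNReal.ofReal (t ^ (δ * q.toReal - 1)) ∂halfLine := by
      refine setLIntegral_congr_fun measurableSet_Ioo fun t ht => ?_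
      simp only [enorm_eq_self]
      rw [ENNReal.ofReal_rpow_of_nonneg (Real.rpow_nonneg ht.1.le _) hqr.le,
        ← Real.rpow_mul ht.1.le]
      congr 2
      field_simp
    rw [this, lintegral_Ioo_rpow ha.le (by positivity),
      ENNReal.ofReal_rpow_of_nonneg (by positivity) (by positivity)]
    apply le_of_eq
    congr 1
    rw [div_eq_inv_mul, Real.mul_rpow (by positivity) (by positivity), ← Real.rpow_mul ha.le]
    congr 2
    field_simp

/-- Half of the power t^θ pays for replacing b(t) by b(a), at the cost of (a/t)^(θ/2). The remaining
half still has finite norm near 0. -/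
lemma eLpNorm_indicator_weight_le {q : ℝ≥0∞} (hq : 1 ≤ q) {θ : ℝ} (hθ : 0 < θ) (a₀ a₁ : ℝ) :
    ∃ C : ℝ, 0 < C ∧ ∀ a, 0 < a →
      eLpNorm ((Ioo 0 a).indicator (weight θ q a₀ a₁)) q halfLine ≤
        ENNReal.ofReal (C * a ^ θ * brokenLog a₀ a₁ a) := by
  obtain ⟨C, hC, hb⟩ := brokenLog_le_rpow a₀ a₁ (half_pos hθ)
  obtain ⟨D, hD, hd⟩ := eLpNorm_indicator_rpow_le hq (half_pos hθ)
  refine ⟨C * D, by positivity, fun a ha => ?_⟩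
  have hba := brokenLog_pos (a₀ := a₀) (a₁ := a₁) ha
  have h1 : eLpNorm ((Ioo 0 a).indicator (weight θ q a₀ a₁)) q halfLine ≤
      ENNReal.ofReal (C * a ^ (θ / 2) * brokenLog a₀ a₁ a) * eLpNorm ((Ioo 0 a).indicator
        fun t => ENNReal.ofReal (t ^ (θ / 2 - (q⁻¹).toReal))) q halfLine := by
    refine eLpNorm_le_ofReal_mul q (Filter.Eventually.of_forall fun t => ?_)
    by_cases h : t ∈ Ioo 0 a
    · rw [indicator_of_mem h, indicator_of_mem h, weight, ← ENNReal.ofReal_mul (by positivity)]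
      apply ENNReal.ofReal_le_ofReal
      have ht := h.1
      have := (hb t a ht h.2.le).2
      calc t ^ (θ - (q⁻¹).toReal) * brokenLog a₀ a₁ t
          ≤ t ^ (θ - (q⁻¹).toReal) * (C * (a / t) ^ (θ / 2) * brokenLog a₀ a₁ a) := by gcongr
        _ = t ^ (θ / 2 + (θ / 2 - (q⁻¹).toReal)) *
              (C * (a ^ (θ / 2) / t ^ (θ / 2)) * brokenLog a₀ a₁ a) := by
            rw [Real.div_rpow ha.le ht.le]; congr 2; ring
        _ = _ := by
            rw [Real.rpow_add ht]
            have := (Real.rpow_pos_of_pos ht (θ / 2)).ne'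
            field_simp
    · simp [h]
  refine h1.trans ((mul_le_mul_right (hd a ha) _).trans (le_of_eq ?_))
  rw [← ENNReal.ofReal_mul (by positivity)]
  congr 1
  rw [show a ^ θ = a ^ (θ / 2) * a ^ (θ / 2) by rw [← Real.rpow_add ha]; congr 1; ring]
  ring

/-- On (t/2, t) one has f* ≥ f*(t), and the weight is comparable to its value at t. Restricting the
norm to this interval gives the bound. -/
lemma rearrangement_mul_le_lzNorm (p : ℝ≥0∞) {q : ℝ≥0∞} (hq : 1 ≤ q) (a₀ a₁ : ℝ) :
    ∃ C : ℝ, 0 < C ∧ ∀ (f : ℝ → ℝ≥0∞) (t : ℝ), 0 < t →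
      ENNReal.ofReal (t ^ (p⁻¹).toReal * brokenLog a₀ a₁ t) * rearrangement halfLine f t ≤
        ENNReal.ofReal C * lzNorm p q a₀ a₁ f := by
  obtain ⟨C, hC, hb⟩ := brokenLog_le_rpow a₀ a₁ one_pos
  set θ := (p⁻¹).toReal
  set σ := (q⁻¹).toReal with hσ
  have hσ0 : 0 ≤ σ := ENNReal.toReal_nonneg
  refine ⟨2 ^ σ * (2 ^ |θ - σ| * (C * 2)), by positivity, fun f t ht => ?_⟩
  have hbt := brokenLog_pos (a₀ := a₀) (a₁ := a₁) ht
  set ν := halfLine.restrict (Ioo (t / 2) t)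
  have hνuniv : ν univ = ENNReal.ofReal (t / 2) := by
    rw [Measure.restrict_apply_univ, halfLine, Measure.restrict_apply measurableSet_Ioo,
      inter_eq_left.2 fun x hx => mem_Ioi.2 ((half_pos ht).trans hx.1), Real.volume_Ioo]
    congr 1; ring
  have hν0 : ν ≠ 0 := by
    intro h
    rw [h] at hνuniv
    simp only [Measure.coe_zero, Pi.zero_apply] at hνuniv
    have := (ENNReal.ofReal_eq_zero.1 hνuniv.symm)
    linarith
  have h1 : eLpNorm (fun _ : ℝ =>
      ENNReal.ofReal (t ^ (θ - σ) * brokenLog a₀ a₁ t) * rearrangement halfLine f t) q ν ≤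
      ENNReal.ofReal (2 ^ |θ - σ| * (C * 2)) * lzNorm p q a₀ a₁ f := by
    refine (eLpNorm_le_ofReal_mul (c := 2 ^ |θ - σ| * (C * 2)) (g := fun s =>
      ENNReal.ofReal (s ^ (θ - σ) * brokenLog a₀ a₁ s) * rearrangement halfLine f s) q ?_).trans
        (mul_le_mul_right (eLpNorm_mono_measure _ Measure.restrict_le_self) _)
    filter_upwards [ae_restrict_mem measurableSet_Ioo] with s hs
    have hs0 : 0 < s := (half_pos ht).trans hs.1
    have hbs := brokenLog_pos (a₀ := a₀) (a₁ := a₁) hs0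
    rw [← mul_assoc, ← ENNReal.ofReal_mul (by positivity)]
    refine mul_le_mul' (ENNReal.ofReal_le_ofReal ?_) (rearrangement_antitone f hs.2.le)
    have e1 : t ^ (θ - σ) ≤ 2 ^ |θ - σ| * s ^ (θ - σ) :=
      rpow_le_mul_rpow ht hs0 one_le_two (by linarith [hs.1]) (by linarith [hs.2]) _
    have e2 : brokenLog a₀ a₁ t ≤ C * 2 * brokenLog a₀ a₁ s := by
      refine (hb s t hs0 hs.2.le).1.trans ?_
      gcongr
      rw [Real.rpow_one, div_le_iff₀ hs0]
      linarith [hs.1]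
    calc _ ≤ (2 ^ |θ - σ| * s ^ (θ - σ)) * (C * 2 * brokenLog a₀ a₁ s) := by gcongr
      _ = _ := by ring
  have hq0 : q ≠ 0 := (zero_lt_one.trans_le hq).ne'
  rw [eLpNorm_const _ hq0 hν0, hνuniv, enorm_eq_self, ← toReal_inv_eq, ← hσ,
    ENNReal.ofReal_rpow_of_pos (half_pos ht)] at h1
  calc ENNReal.ofReal (t ^ θ * brokenLog a₀ a₁ t) * rearrangement halfLine f t
      = ENNReal.ofReal (2 ^ σ) * (ENNReal.ofReal (t ^ (θ - σ) * brokenLog a₀ a₁ t) *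
          rearrangement halfLine f t * ENNReal.ofReal ((t / 2) ^ σ)) := by
        rw [mul_right_comm, ← mul_assoc, ← ENNReal.ofReal_mul (by positivity),
          ← ENNReal.ofReal_mul (by positivity)]
        congr 2
        rw [Real.div_rpow ht.le two_pos.le, show θ = θ - σ + σ by ring, Real.rpow_add ht]
        have : (2 : ℝ) ^ σ ≠ 0 := by positivity
        field_simp
        ring_nf
    _ ≤ ENNReal.ofReal (2 ^ σ) * (ENNReal.ofReal (2 ^ |θ - σ| * (C * 2)) * lzNorm p q a₀ a₁ f) := by
        gcongr
    _ = _ := by rw [← mul_assoc, ← ENNReal.ofReal_mul (by positivity)]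

/-! ### The supremum operator and duality with dilations -/

lemma abs_coe_ennreal (x : ℝ≥0∞) : ((x : EReal)).abs = x := by
  induction x with
  | top => rfl
  | coe x =>
    change ENNReal.ofReal |(x : ℝ)| = x
    simp

lemma measurable_ereal_abs : Measurable EReal.abs := by
  refine EReal.measurable_of_measurable_real ?_
  simp only [EReal.abs_def]
  fun_prop

/-- The supremum operator acting on nonnegative functions, without rearrangement. -/
def supFun (α : ℝ) (u : ℝ → ℝ≥0∞) (t : ℝ) : ℝ≥0∞ :=
  ENNReal.ofReal (t ^ (-α)) * ⨆ s ∈ Ici t, ENNReal.ofReal (s ^ α) * u s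

lemma measurable_supFun (α : ℝ) (u : ℝ → ℝ≥0∞) : Measurable (supFun α u) := by
  refine (ENNReal.measurable_ofReal.comp (measurable_id.pow_const _)).mul (Antitone.measurable ?_)
  intro s t hst
  exact biSup_mono fun r hr => hst.trans hr

lemma antitoneOn_supFun {α : ℝ} (hα : 0 < α) (u : ℝ → ℝ≥0∞) :
    AntitoneOn (supFun α u) (Ioi 0) := by
  intro s hs t ht hst
  refine mul_le_mul' (ENNReal.ofReal_le_ofReal ?_) (biSup_mono fun r hr => hst.trans hr)
  exact Real.rpow_le_rpow_of_nonpos hs hst (by linarith)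

lemma absFun_supOperator (α : ℝ) (f : ℝ → EReal) :
    absFun (supOperator α f) = supFun α (rearrangement halfLine (absFun f)) := by
  funext t
  exact abs_coe_ennreal _

lemma boundedOn_supOperator (α : ℝ) (ρ : (ℝ → ℝ≥0∞) → ℝ≥0∞) (C : ℝ≥0)
    (h : ∀ g : ℝ → ℝ≥0∞, AEMeasurable g halfLine →
      ρ (supFun α (rearrangement halfLine g)) ≤ C * ρ g) :
    BoundedOn halfLine ρ (supOperator α) := by
  refine ⟨C, fun f hf => ?_⟩
  have hle := h (absFun f) (measurable_ereal_abs.comp_aemeasurable hf.1)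
  rw [← absFun_supOperator] at hle
  refine ⟨⟨?_, hle.trans_lt (ENNReal.mul_lt_top ENNReal.coe_lt_top hf.2)⟩, hle⟩
  exact (measurable_coe_ennreal_ereal.comp
    (measurable_supFun α (rearrangement halfLine (absFun f)))).aemeasurable

/-- The Hölder inequality between `g^*` and a dilated nonincreasing function. -/
lemma lintegral_rearrangement_mul_div_le (p q : ℝ≥0∞) (a₀ a₁ : ℝ) {ε : ℝ} (hε : 0 < ε) :
    ∃ C : ℝ, 0 < C ∧ ∀ c, 1 ≤ c → ∀ g u : ℝ → ℝ≥0∞, AEMeasurable g halfLine → Measurable u →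
      AntitoneOn u (Ioi 0) →
      eLpNorm (fun t => weight (p⁻¹).toReal q a₀ a₁ t * u t) q halfLine ≤ 1 →
      ∫⁻ t, rearrangement halfLine g t * u (t / c) ∂halfLine ≤
        ENNReal.ofReal (C * c ^ ((p⁻¹).toReal + ε)) *
          associate halfLine (lzNorm p q a₀ a₁) g := by
  set θ := (p⁻¹).toReal with hθ
  obtain ⟨C, hC, hdil⟩ := eLpNorm_weight_mul_div_le θ q a₀ a₁ hε
  refine ⟨12 * (C * 2 ^ (θ + ε)), by positivity, fun c hc g u hg hu hanti hle => ?_⟩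
  have hc0 : 0 < c := one_pos.trans_le hc
  -- The factor is 2c rather than c because the converse Hardy-Littlewood inequality asks for
  -- normalization after a further dilation by 2.
  set K := C * (2 * c) ^ (θ + ε) with hK
  have hK0 : 0 < K := by positivity
  have h1 : eLpNorm (fun t => weight θ q a₀ a₁ t * (ENNReal.ofReal K⁻¹ * u (t / 2 / c))) q
      halfLine ≤ 1 := by
    calc _ ≤ ENNReal.ofReal K⁻¹ *
          eLpNorm (fun t => weight θ q a₀ a₁ t * u (t / (2 * c))) q halfLine := by
          refine eLpNorm_le_ofReal_mul q (Filter.Eventually.of_forall fun t => le_of_eq ?_)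
          rw [div_div]; ring
      _ ≤ ENNReal.ofReal K⁻¹ * (ENNReal.ofReal K * 1) := by
          gcongr
          exact (hdil (2 * c) (by linarith) u).trans (by gcongr)
      _ = 1 := by
          rw [mul_one, ← ENNReal.ofReal_mul (by positivity), inv_mul_cancel₀ hK0.ne',
            ENNReal.ofReal_one]
  have hmeas : Measurable fun t => u (t / c) := hu.comp (measurable_id.div_const c)
  have h2 := lintegral_rearrangement_mul_le_associate p q a₀ a₁ hg
    (h := fun t => ENNReal.ofReal K⁻¹ * u (t / c)) (hmeas.const_mul _)
    (fun s hs t ht hst => by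
      refine mul_le_mul_right (hanti (div_pos hs hc0) (div_pos ht hc0) ?_) _
      gcongr) h1
  calc ∫⁻ t, rearrangement halfLine g t * u (t / c) ∂halfLine
      = ENNReal.ofReal K * ∫⁻ t, rearrangement halfLine g t *
          (ENNReal.ofReal K⁻¹ * u (t / c)) ∂halfLine := by
        rw [← lintegral_const_mul' _ _ ENNReal.ofReal_ne_top]
        refine lintegral_congr fun t => ?_
        have hKK : ENNReal.ofReal K * ENNReal.ofReal K⁻¹ = 1 := by
          rw [← ENNReal.ofReal_mul hK0.le, mul_inv_cancel₀ hK0.ne', ENNReal.ofReal_one]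
        calc _ = (ENNReal.ofReal K * ENNReal.ofReal K⁻¹) *
              (rearrangement halfLine g t * u (t / c)) := by rw [hKK, one_mul]
          _ = _ := by ring
    _ ≤ ENNReal.ofReal K * (12 * associate halfLine (lzNorm p q a₀ a₁) g) := by gcongr
    _ = _ := by
        rw [← mul_assoc, ← ENNReal.ofReal_ofNat 12, ← ENNReal.ofReal_mul (by positivity)]
        congr 2
        rw [hK, Real.mul_rpow two_pos.le hc0.le]; ring

/-! ### Sufficiency -/

/-- A point s with 2^k t ≤ s < 2^(k+1) t is covered by the k-th term; the sum over k replaces the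
supremum. -/
lemma supFun_le_tsum {α : ℝ} (hα : 0 < α) {u : ℝ → ℝ≥0∞} (hu : Antitone u) {t : ℝ} (ht : 0 < t) :
    supFun α u t ≤ ∑' k : ℕ, ENNReal.ofReal (2 ^ α * (2 ^ k) ^ α) * u (2 ^ k * t) := by
  rw [supFun, ENNReal.mul_iSup]
  refine iSup_le fun s => ?_
  rw [ENNReal.mul_iSup]
  refine iSup_le fun (hs : t ≤ s) => ?_
  have hs0 := ht.trans_le hs
  obtain ⟨k, hk1, hk2⟩ := exists_nat_pow_near ((one_le_div ht).2 hs) (one_lt_two)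
  refine le_trans ?_ (ENNReal.le_tsum k)
  rw [← mul_assoc, ← ENNReal.ofReal_mul (by positivity)]
  refine mul_le_mul' (ENNReal.ofReal_le_ofReal ?_) (hu ((le_div_iff₀ ht).1 hk1))
  calc t ^ (-α) * s ^ α = (s / t) ^ α := by
        rw [Real.div_rpow hs0.le ht.le, Real.rpow_neg ht.le]; field_simp
    _ ≤ (2 * 2 ^ k) ^ α := by
        refine Real.rpow_le_rpow (by positivity) ?_ hα.le
        rw [pow_succ] at hk2; linarith
    _ = _ := by rw [Real.mul_rpow two_pos.le (by positivity)]

lemma exists_associate_supFun_le_of_lt {p : ℝ≥0∞} (q : ℝ≥0∞) (a₀ a₁ : ℝ) {α : ℝ} (hα : 0 < α)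
    (hp : (p⁻¹).toReal + α < 1) :
    ∃ C : ℝ≥0, ∀ g : ℝ → ℝ≥0∞, AEMeasurable g halfLine →
      associate halfLine (lzNorm p q a₀ a₁) (supFun α (rearrangement halfLine g)) ≤
        C * associate halfLine (lzNorm p q a₀ a₁) g := by
  set θ := (p⁻¹).toReal with hθ
  set ε := (1 - θ - α) / 2 with hε
  have hε0 : 0 < ε := by rw [hε]; linarith
  obtain ⟨C, hC, hH⟩ := lintegral_rearrangement_mul_div_le p q a₀ a₁ hε0
  -- By the choice of ε as half the gap 1 - θ - α, this ratio equals 2^(-ε).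
  set r : ℝ := 2 ^ (α - 1 + (θ + ε)) with hr
  have hr0 : 0 < r := by positivity
  have hr1 : r < 1 := Real.rpow_lt_one_of_one_lt_of_neg one_lt_two (by rw [hε]; linarith)
  set D : ℝ≥0∞ := ∑' k : ℕ, ENNReal.ofReal (2 ^ α * C) * ENNReal.ofReal r ^ k with hD
  have hDtop : D ≠ ∞ := by
    rw [hD, ENNReal.tsum_mul_left, ENNReal.tsum_geometric]
    refine ENNReal.mul_ne_top ENNReal.ofReal_ne_top (ENNReal.inv_ne_top.2 ?_)
    rw [← pos_iff_ne_zero, tsub_pos_iff_lt, ENNReal.ofReal_lt_one]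
    exact hr1
  refine ⟨D.toNNReal, fun g hg => ?_⟩
  rw [ENNReal.coe_toNNReal hDtop]
  refine iSup_le fun f => iSup_le fun hf => iSup_le fun hρ => ?_
  set A := associate halfLine (lzNorm p q a₀ a₁) g
  have hfm := measurable_rearrangement (μ := halfLine) f
  have hgm := measurable_rearrangement (μ := halfLine) g
  have hgk : ∀ k : ℕ, Measurable fun t => rearrangement halfLine g (2 ^ k * t) := fun k =>
    hgm.comp (measurable_id.const_mul _)
  calc ∫⁻ t, f t * supFun α (rearrangement halfLine g) t ∂halfLine
      ≤ ∫⁻ t, rearrangement halfLine f t * supFun α (rearrangement halfLine g) t ∂halfLine :=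
        lintegral_mul_le_lintegral_rearrangement_mul hf (measurable_supFun _ _)
          (antitoneOn_supFun hα _)
    _ ≤ ∫⁻ t, ∑' k : ℕ, ENNReal.ofReal (2 ^ α * (2 ^ k) ^ α) *
          (rearrangement halfLine f t * rearrangement halfLine g (2 ^ k * t)) ∂halfLine := by
        apply lintegral_mono_ae
        filter_upwards [ae_halfLine_pos] with t ht
        refine (mul_le_mul_right (supFun_le_tsum hα (rearrangement_antitone g) ht) _).trans ?_
        rw [← ENNReal.tsum_mul_left]
        exact ENNReal.tsum_le_tsum fun k => le_of_eq (mul_left_comm _ _ _)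
    _ = ∑' k : ℕ, ENNReal.ofReal (2 ^ α * (2 ^ k) ^ α) *
          ∫⁻ t, rearrangement halfLine f t * rearrangement halfLine g (2 ^ k * t) ∂halfLine := by
        have hm : ∀ k : ℕ, Measurable fun t =>
            rearrangement halfLine f t * rearrangement halfLine g (2 ^ k * t) :=
          fun k => hfm.mul (hgk k)
        rw [lintegral_tsum fun k => ((hm k).const_mul _).aemeasurable]
        exact tsum_congr fun k => lintegral_const_mul _ (hm k)
    _ ≤ ∑' k : ℕ, ENNReal.ofReal (2 ^ α * C) * ENNReal.ofReal r ^ k * A := by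
        refine ENNReal.tsum_le_tsum fun k => ?_
        have h2k : (0 : ℝ) < 2 ^ k := by positivity
        -- Substitution moves the dilation from g* to f* and gains 2^(-k), which beats 2^(kα)
        -- together with the dilation cost on f*.
        have e1 : ∫⁻ t, rearrangement halfLine f t * rearrangement halfLine g (2 ^ k * t) ∂halfLine =
            ENNReal.ofReal ((2 ^ k)⁻¹) *
              ∫⁻ t, rearrangement halfLine g t * rearrangement halfLine f (t / 2 ^ k) ∂halfLine := by
          have := lintegral_div_halfLine (fun t => rearrangement halfLine f t *
            rearrangement halfLine g (2 ^ k * t)) h2k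
          simp only [mul_div_cancel₀ _ h2k.ne'] at this
          simp only [mul_comm (rearrangement halfLine g _)]
          rw [this, ← mul_assoc, ← ENNReal.ofReal_mul (by positivity), inv_mul_cancel₀ h2k.ne',
            ENNReal.ofReal_one, one_mul]
        have e2 := hH (2 ^ k) (one_le_pow₀ one_le_two) g (rearrangement halfLine f) hg hfm
          ((rearrangement_antitone f).antitoneOn _) hρ
        rw [e1]
        refine (mul_le_mul_right (mul_le_mul_right e2 _) _).trans (le_of_eq ?_)
        rw [← mul_assoc, ← mul_assoc, ← ENNReal.ofReal_mul (by positivity),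
          ← ENNReal.ofReal_mul (by positivity), ← ENNReal.ofReal_pow hr0.le,
          ← ENNReal.ofReal_mul (by positivity)]
        congr 2
        have : r ^ k = (2 ^ k) ^ α * (2 ^ k : ℝ)⁻¹ * (2 ^ k) ^ (θ + ε) := by
          rw [← Real.rpow_neg_one (2 ^ k : ℝ), ← Real.rpow_add h2k, ← Real.rpow_add h2k, hr,
            ← Real.rpow_natCast, ← Real.rpow_mul two_pos.le, ← Real.rpow_natCast,
            ← Real.rpow_mul two_pos.le]
          congr 1; ring
        rw [this]; ring
    _ = D * A := by rw [ENNReal.tsum_mul_right]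

/-- Pair g* with the normalized characteristic function of (0,s), on which g* ≥ g*(s). -/
lemma rearrangement_mul_le_associate (p : ℝ≥0∞) {q : ℝ≥0∞} (hq : 1 ≤ q) (a₀ a₁ : ℝ)
    (hp : 0 < (p⁻¹).toReal) :
    ∃ C : ℝ, 0 < C ∧ ∀ g : ℝ → ℝ≥0∞, AEMeasurable g halfLine → ∀ s, 0 < s →
      rearrangement halfLine g s * ENNReal.ofReal s ≤
        ENNReal.ofReal (C * s ^ (p⁻¹).toReal * brokenLog a₀ a₁ s) *
          associate halfLine (lzNorm p q a₀ a₁) g := by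
  obtain ⟨C, hC, hH⟩ := lintegral_rearrangement_mul_div_le p q a₀ a₁ one_pos
  obtain ⟨D, hD, hd⟩ := eLpNorm_indicator_weight_le hq hp a₀ a₁
  refine ⟨D * C, by positivity, fun g hg s hs => ?_⟩
  have hb := brokenLog_pos (a₀ := a₀) (a₁ := a₁) hs
  set θ := (p⁻¹).toReal
  set K := D * s ^ θ * brokenLog a₀ a₁ s with hK
  have hK0 : 0 < K := by positivity
  set u : ℝ → ℝ≥0∞ := (Iio s).indicator fun _ => ENNReal.ofReal K⁻¹ with hu
  have hu1 : eLpNorm (fun t => weight θ q a₀ a₁ t * u t) q halfLine ≤ 1 := by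
    calc eLpNorm (fun t => weight θ q a₀ a₁ t * u t) q halfLine
        ≤ ENNReal.ofReal K⁻¹ * eLpNorm ((Ioo 0 s).indicator (weight θ q a₀ a₁)) q halfLine := by
          apply eLpNorm_le_ofReal_mul
          filter_upwards [ae_halfLine_pos] with t ht
          by_cases h : t < s
          · rw [hu, indicator_of_mem (mem_Iio.2 h), indicator_of_mem (mem_Ioo.2 ⟨ht, h⟩), mul_comm]
          · simp [hu, h]
      _ ≤ ENNReal.ofReal K⁻¹ * ENNReal.ofReal K := by gcongr; exact hd s hs
      _ = 1 := by
          rw [← ENNReal.ofReal_mul (by positivity), inv_mul_cancel₀ hK0.ne', ENNReal.ofReal_one]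
  have hanti : Antitone u := by
    intro x y hxy
    by_cases hy : y < s
    · rw [hu, indicator_of_mem (mem_Iio.2 hy), indicator_of_mem (mem_Iio.2 (hxy.trans_lt hy))]
    · simp [hu, hy]
  have h1 := hH 1 le_rfl g u hg (measurable_const.indicator measurableSet_Iio)
    (hanti.antitoneOn _) hu1
  simp only [div_one, Real.one_rpow, mul_one] at h1
  have h2 : rearrangement halfLine g s * ENNReal.ofReal K⁻¹ * ENNReal.ofReal s ≤
      ∫⁻ t, rearrangement halfLine g t * u t ∂halfLine := by
    calc _ = ∫⁻ t in Ioo 0 s, rearrangement halfLine g s * ENNReal.ofReal K⁻¹ ∂halfLine := by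
          rw [setLIntegral_const, halfLine_Ioo]
      _ ≤ ∫⁻ t in Ioo 0 s, rearrangement halfLine g t * u t ∂halfLine := by
          refine setLIntegral_mono ((measurable_rearrangement g).mul hanti.measurable)
            fun t ht => ?_
          rw [hu, indicator_of_mem (mem_Iio.2 ht.2)]
          gcongr
          exact rearrangement_antitone g ht.2.le
      _ ≤ _ := setLIntegral_le_lintegral _ _
  calc rearrangement halfLine g s * ENNReal.ofReal s
      = ENNReal.ofReal K * (rearrangement halfLine g s * ENNReal.ofReal K⁻¹ * ENNReal.ofReal s) := by
        have hKK : ENNReal.ofReal K * ENNReal.ofReal K⁻¹ = 1 := by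
          rw [← ENNReal.ofReal_mul hK0.le, mul_inv_cancel₀ hK0.ne', ENNReal.ofReal_one]
        calc _ = (ENNReal.ofReal K * ENNReal.ofReal K⁻¹) *
              (rearrangement halfLine g s * ENNReal.ofReal s) := by rw [hKK, one_mul]
          _ = _ := by ring
    _ ≤ ENNReal.ofReal K * (ENNReal.ofReal C * associate halfLine (lzNorm p q a₀ a₁) g) := by
        exact mul_le_mul_right (h2.trans h1) _
    _ = _ := by
        rw [← mul_assoc, ← ENNReal.ofReal_mul (by positivity)]
        congr 2
        rw [hK]; ring

lemma brokenLog_antitoneOn {a₀ a₁ : ℝ} (h₀ : 0 ≤ a₀) (h₁ : a₁ ≤ 0) :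
    AntitoneOn (brokenLog a₀ a₁) (Ioi 0) := by
  intro s hs t ht hst
  rw [brokenLog_eq hs, brokenLog_eq ht]
  have hl := Real.log_le_log hs hst
  have h1 := le_max_left 0 (-Real.log t)
  have h2 := le_max_left 0 (Real.log s)
  have h3 := le_max_left 0 (Real.log t)
  refine mul_le_mul (Real.rpow_le_rpow (by positivity) (by gcongr) h₀)
    (Real.rpow_le_rpow_of_nonpos (by positivity) (by gcongr) h₁) (by positivity) ?_
  have h4 := le_max_left 0 (-Real.log s)
  positivity

/-- Since θ = 1 - α, the preceding bound reads s^α g*(s) ≤ C b(s) A. Monotonicity of b puts the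
supremum over s ≥ t below C b(t) A, and q = 1 makes t^(-α) b(t) the weight itself. -/
lemma exists_associate_supFun_le_of_eq {p : ℝ≥0∞} {a₀ a₁ : ℝ} {α : ℝ} (hα : 0 < α) (hα₁ : α < 1)
    (hp : (p⁻¹).toReal = 1 - α) (h₀ : 0 ≤ a₀) (h₁ : a₁ ≤ 0) :
    ∃ C : ℝ≥0, ∀ g : ℝ → ℝ≥0∞, AEMeasurable g halfLine →
      associate halfLine (lzNorm p 1 a₀ a₁) (supFun α (rearrangement halfLine g)) ≤
        C * associate halfLine (lzNorm p 1 a₀ a₁) g := by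
  obtain ⟨C, hC, hH⟩ := rearrangement_mul_le_associate p le_rfl a₀ a₁ (by rw [hp]; linarith)
  refine ⟨C.toNNReal, fun g hg => ?_⟩
  change _ ≤ ENNReal.ofReal C * _
  refine iSup_le fun f => iSup_le fun hf => iSup_le fun hρ => ?_
  set A := associate halfLine (lzNorm p 1 a₀ a₁) g
  have hpt : ∀ t, 0 < t → supFun α (rearrangement halfLine g) t ≤
      ENNReal.ofReal C * A * weight (1 - α) 1 a₀ a₁ t := by
    intro t ht
    have hbt := brokenLog_pos (a₀ := a₀) (a₁ := a₁) ht
    have hsup : ⨆ s ∈ Ici t, ENNReal.ofReal (s ^ α) * rearrangement halfLine g s ≤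
        ENNReal.ofReal (C * brokenLog a₀ a₁ t) * A := by
      refine iSup₂_le fun s hs => ?_
      have hs0 : 0 < s := ht.trans_le hs
      have hbs := brokenLog_pos (a₀ := a₀) (a₁ := a₁) hs0
      calc ENNReal.ofReal (s ^ α) * rearrangement halfLine g s
          = ENNReal.ofReal (s ^ (α - 1)) * (rearrangement halfLine g s * ENNReal.ofReal s) := by
            rw [mul_comm (rearrangement halfLine g s), ← mul_assoc,
              ← ENNReal.ofReal_mul (by positivity), Real.rpow_sub_one hs0.ne',
              div_mul_cancel₀ _ hs0.ne']
        _ ≤ ENNReal.ofReal (s ^ (α - 1)) *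
              (ENNReal.ofReal (C * s ^ (p⁻¹).toReal * brokenLog a₀ a₁ s) * A) := by
            exact mul_le_mul_right (hH g hg s hs0) _
        _ = ENNReal.ofReal (C * brokenLog a₀ a₁ s) * A := by
            rw [← mul_assoc, ← ENNReal.ofReal_mul (by positivity), hp]
            congr 2
            have : s ^ (α - 1) * s ^ (1 - α) = 1 := by
              rw [← Real.rpow_add hs0]; simp
            linear_combination (C * brokenLog a₀ a₁ s) * this
        _ ≤ _ := by
            gcongr
            exact brokenLog_antitoneOn h₀ h₁ ht hs0 hs
    refine (mul_le_mul_right hsup _).trans (le_of_eq ?_)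
    rw [weight, ← mul_assoc, ← ENNReal.ofReal_mul (by positivity), mul_right_comm,
      ← ENNReal.ofReal_mul hC.le]
    congr 2
    have : (1 - α - ((1 : ℝ≥0∞)⁻¹).toReal) = -α := by simp
    rw [this]; ring
  calc ∫⁻ t, f t * supFun α (rearrangement halfLine g) t ∂halfLine
      ≤ ∫⁻ t, rearrangement halfLine f t * supFun α (rearrangement halfLine g) t ∂halfLine :=
        lintegral_mul_le_lintegral_rearrangement_mul hf (measurable_supFun _ _)
          (antitoneOn_supFun hα _)
    _ ≤ ∫⁻ t, ENNReal.ofReal C * A *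
          (weight (1 - α) 1 a₀ a₁ t * rearrangement halfLine f t) ∂halfLine := by
        apply lintegral_mono_ae
        filter_upwards [ae_halfLine_pos] with t ht
        refine (mul_le_mul_right (hpt t ht) _).trans (le_of_eq ?_)
        ring
    _ = ENNReal.ofReal C * A * lzNorm p 1 a₀ a₁ f := by
        have hw : Measurable (weight (1 - α) 1 a₀ a₁) := ENNReal.measurable_ofReal.comp
          ((measurable_id.pow_const _).mul (measurable_brokenLog a₀ a₁))
        have hm : Measurable fun t => weight (1 - α) 1 a₀ a₁ t * rearrangement halfLine f t :=
          hw.mul (measurable_rearrangement f)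
        rw [lintegral_const_mul _ hm, lzNorm, eLpNorm_one_eq_lintegral_enorm, hp]
        rfl
    _ ≤ ENNReal.ofReal C * A * 1 := by gcongr
    _ = _ := mul_one _

/-! ### Necessity: testing on characteristic functions -/

lemma one_le_rearrangement_indicator {b s : ℝ} (hb : 0 < b) (hsb : s < b) :
    1 ≤ rearrangement halfLine ((Iio b).indicator 1) s := by
  refine le_of_forall_lt fun c hc => ?_
  rw [lt_rearrangement_iff]
  have hset : Ioo 0 b ⊆ {x | c < (Iio b).indicator (1 : ℝ → ℝ≥0∞) x} := by
    intro x hx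
    change c < (Iio b).indicator (1 : ℝ → ℝ≥0∞) x
    rw [indicator_of_mem (mem_Iio.2 hx.2)]
    exact hc
  refine lt_of_lt_of_le ?_ (measure_mono hset)
  rw [halfLine_Ioo]
  exact (ENNReal.ofReal_lt_ofReal_iff hb).2 hsb

/-- Take s = N in the supremum. The interval is doubled so that N lies strictly inside it, where the
rearrangement is at least 1. -/
lemma le_supFun_indicator {α : ℝ} {N t : ℝ} (hN : 0 < N) (ht : t ∈ Ioo 0 N) :
    ENNReal.ofReal (t ^ (-α)) * ENNReal.ofReal (N ^ α) ≤
      supFun α (rearrangement halfLine ((Iio (2 * N)).indicator 1)) t := by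
  refine mul_le_mul_right (le_trans ?_ (le_iSup₂ (f := fun s (_ : s ∈ Ici t) =>
    ENNReal.ofReal (s ^ α) * rearrangement halfLine ((Iio (2 * N)).indicator 1) s) N
    (mem_Ici.2 ht.2.le))) _
  calc ENNReal.ofReal (N ^ α) = ENNReal.ofReal (N ^ α) * 1 := (mul_one _).symm
    _ ≤ _ := mul_le_mul_right (one_le_rearrangement_indicator (by linarith) (by linarith)) _

/-- Testing the boundedness of the supremum operator on characteristic functions. -/
lemma exists_lintegral_le_of_boundedOn {p q : ℝ≥0∞} {a₀ a₁ α : ℝ}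
    (hT : BoundedOn halfLine (associate halfLine (lzNorm p q a₀ a₁)) (supOperator α)) :
    ∃ C : ℝ≥0, ∀ N, 0 < N →
      associate halfLine (lzNorm p q a₀ a₁) ((Iio (2 * N)).indicator 1) < ∞ →
      ∀ (h : ℝ → ℝ≥0∞) (K : ℝ), Measurable h → AntitoneOn h (Ioi 0) → 0 < K →
        eLpNorm (fun t => weight (p⁻¹).toReal q a₀ a₁ t * h t) q halfLine ≤ ENNReal.ofReal K →
        ∫⁻ t in Ioo 0 N, h t * (ENNReal.ofReal (t ^ (-α)) * ENNReal.ofReal (N ^ α)) ∂halfLine ≤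
          ENNReal.ofReal K *
            (C * associate halfLine (lzNorm p q a₀ a₁) ((Iio (2 * N)).indicator 1)) := by
  obtain ⟨C, hC⟩ := hT
  refine ⟨C, fun N hN hfin h K hh hanti hK hle => ?_⟩
  set ρ := lzNorm p q a₀ a₁ with hρ
  set χ : ℝ → ℝ≥0∞ := (Iio (2 * N)).indicator 1 with hχ
  have habs : absFun (fun t => (χ t : EReal)) = χ := by
    funext t; exact abs_coe_ennreal _
  have hχm : Measurable χ := measurable_one.indicator measurableSet_Iio
  have h1 := (hC (fun t => (χ t : EReal))
    ⟨(measurable_coe_ennreal_ereal.comp hχm).aemeasurable, by rwa [habs]⟩).2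
  rw [absFun_supOperator, habs] at h1
  have hKK : ENNReal.ofReal K * ENNReal.ofReal K⁻¹ = 1 := by
    rw [← ENNReal.ofReal_mul hK.le, mul_inv_cancel₀ hK.ne', ENNReal.ofReal_one]
  have hanti' : AntitoneOn (fun t => ENNReal.ofReal K⁻¹ * h t) (Ioi 0) := fun s hs t ht hst =>
    mul_le_mul_right (hanti hs ht hst) _
  have h2 : ρ (fun t => ENNReal.ofReal K⁻¹ * h t) ≤ 1 := by
    calc ρ (fun t => ENNReal.ofReal K⁻¹ * h t)
        ≤ ENNReal.ofReal K⁻¹ *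
            eLpNorm (fun t => weight (p⁻¹).toReal q a₀ a₁ t * h t) q halfLine := by
          apply eLpNorm_le_ofReal_mul
          filter_upwards [ae_halfLine_pos] with t ht
          refine (mul_le_mul_right (rearrangement_le_self hanti' ht) _).trans (le_of_eq ?_)
          rw [mul_left_comm]; rfl
      _ ≤ ENNReal.ofReal K⁻¹ * ENNReal.ofReal K := by gcongr
      _ = 1 := by rw [mul_comm, hKK]
  have h3 := (lintegral_mul_le_associate ρ (supFun α (rearrangement halfLine χ))
    (hh.const_mul (ENNReal.ofReal K⁻¹)).aemeasurable h2).trans h1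
  calc ∫⁻ t in Ioo 0 N, h t * (ENNReal.ofReal (t ^ (-α)) * ENNReal.ofReal (N ^ α)) ∂halfLine
      ≤ ∫⁻ t in Ioo 0 N, h t * supFun α (rearrangement halfLine χ) t ∂halfLine :=
        setLIntegral_mono (hh.mul (measurable_supFun _ _)) fun t ht =>
          mul_le_mul_right (le_supFun_indicator hN ht) _
    _ ≤ ∫⁻ t, h t * supFun α (rearrangement halfLine χ) t ∂halfLine :=
        setLIntegral_le_lintegral _ _
    _ = ENNReal.ofReal K * ∫⁻ t, ENNReal.ofReal K⁻¹ * h t *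
          supFun α (rearrangement halfLine χ) t ∂halfLine := by
        rw [← lintegral_const_mul' _ _ ENNReal.ofReal_ne_top]
        refine lintegral_congr fun t => ?_
        rw [← mul_assoc, ← mul_assoc, hKK, one_mul]
    _ ≤ _ := mul_le_mul_right h3 _

lemma lintegral_mul_indicator_le {f : ℝ → ℝ≥0∞} (hf : AEMeasurable f halfLine) (M : ℝ) :
    ∫⁻ t, f t * (Iio M).indicator 1 t ∂halfLine ≤
      ∫⁻ t in Ioo 0 M, rearrangement halfLine f t ∂halfLine := by
  have hanti : Antitone ((Iio M).indicator (1 : ℝ → ℝ≥0∞)) := by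
    intro x y hxy
    by_cases hy : y < M
    · rw [indicator_of_mem (mem_Iio.2 hy), indicator_of_mem (mem_Iio.2 (hxy.trans_lt hy))]
      exact le_rfl
    · simp [hy]
  refine (lintegral_mul_le_lintegral_rearrangement_mul hf hanti.measurable
    (hanti.antitoneOn _)).trans ?_
  rw [← lintegral_indicator measurableSet_Ioo]
  apply lintegral_mono_ae
  filter_upwards [ae_halfLine_pos] with t ht
  by_cases h : t < M
  · simp [indicator, h, ht]
  · simp [h]

/-- The weak-type bound f*(t) ≤ C t^(-θ) / b(t) is integrable at 0 because θ < 1; the spare exponent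
ε absorbs the passage from b(t) to b(M). -/
lemma associate_indicator_le {p q : ℝ≥0∞} (hq : 1 ≤ q) (a₀ a₁ : ℝ) (hp : (p⁻¹).toReal < 1) :
    ∃ C : ℝ, 0 < C ∧ ∀ M, 0 < M →
      associate halfLine (lzNorm p q a₀ a₁) ((Iio M).indicator 1) ≤
        ENNReal.ofReal (C * M ^ (1 - (p⁻¹).toReal) / brokenLog a₀ a₁ M) := by
  obtain ⟨C, hC, hH⟩ := rearrangement_mul_le_lzNorm p hq a₀ a₁
  set θ := (p⁻¹).toReal
  set ε := (1 - θ) / 2 with hε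
  have hε0 : 0 < ε := by rw [hε]; linarith
  obtain ⟨D, hD, hd⟩ := brokenLog_le_rpow a₀ a₁ hε0
  refine ⟨C * D / ε, by positivity, fun M hM => ?_⟩
  have hbM := brokenLog_pos (a₀ := a₀) (a₁ := a₁) hM
  refine iSup_le fun f => iSup_le fun hf => iSup_le fun hρ => ?_
  refine (lintegral_mul_indicator_le hf M).trans ?_
  calc ∫⁻ t in Ioo 0 M, rearrangement halfLine f t ∂halfLine
      ≤ ∫⁻ t in Ioo 0 M, ENNReal.ofReal (C * D * M ^ ε / brokenLog a₀ a₁ M) *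
          ENNReal.ofReal (t ^ (ε - 1)) ∂halfLine := by
        refine setLIntegral_mono (by fun_prop) fun t ht => ?_
        have ht0 := ht.1
        have hbt := brokenLog_pos (a₀ := a₀) (a₁ := a₁) ht0
        have h1 := (hH f t ht0).trans (mul_le_mul_right hρ _)
        have h2 : rearrangement halfLine f t ≤
            ENNReal.ofReal ((t ^ θ * brokenLog a₀ a₁ t)⁻¹ * C) := by
          have hpos : 0 < t ^ θ * brokenLog a₀ a₁ t := by positivity
          have hKK : ENNReal.ofReal (t ^ θ * brokenLog a₀ a₁ t)⁻¹ *
              ENNReal.ofReal (t ^ θ * brokenLog a₀ a₁ t) = 1 := by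
            rw [← ENNReal.ofReal_mul (by positivity), inv_mul_cancel₀ hpos.ne',
              ENNReal.ofReal_one]
          calc rearrangement halfLine f t
              = ENNReal.ofReal (t ^ θ * brokenLog a₀ a₁ t)⁻¹ *
                (ENNReal.ofReal (t ^ θ * brokenLog a₀ a₁ t) * rearrangement halfLine f t) := by
                rw [← mul_assoc, hKK, one_mul]
            _ ≤ ENNReal.ofReal (t ^ θ * brokenLog a₀ a₁ t)⁻¹ * (ENNReal.ofReal C * 1) :=
                mul_le_mul_right h1 _
            _ = _ := by rw [mul_one, ← ENNReal.ofReal_mul (by positivity)]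
        refine h2.trans ?_
        rw [← ENNReal.ofReal_mul (by positivity)]
        apply ENNReal.ofReal_le_ofReal
        have h3 := (hd t M ht0 ht.2.le).1
        rw [Real.div_rpow hM.le ht0.le] at h3
        have e1 : t ^ (ε - 1) = (t ^ θ)⁻¹ * (t ^ ε)⁻¹ := by
          rw [← Real.rpow_neg ht0.le, ← Real.rpow_neg ht0.le, ← Real.rpow_add ht0]
          congr 1; rw [hε]; ring
        have e2 : (brokenLog a₀ a₁ t)⁻¹ ≤ D * (M ^ ε / t ^ ε) / brokenLog a₀ a₁ M := by
          rw [inv_le_iff_one_le_mul₀ hbt, div_mul_eq_mul_div, le_div_iff₀ hbM, one_mul]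
          exact h3
        calc (t ^ θ * brokenLog a₀ a₁ t)⁻¹ * C
            = (t ^ θ)⁻¹ * C * (brokenLog a₀ a₁ t)⁻¹ := by rw [mul_inv]; ring
          _ ≤ (t ^ θ)⁻¹ * C * (D * (M ^ ε / t ^ ε) / brokenLog a₀ a₁ M) := by gcongr
          _ = _ := by rw [e1]; ring
    _ = ENNReal.ofReal (C * D * M ^ ε / brokenLog a₀ a₁ M) * ENNReal.ofReal (M ^ ε / ε) := by
        rw [lintegral_const_mul' _ _ ENNReal.ofReal_ne_top, lintegral_Ioo_rpow hM.le hε0]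
    _ ≤ _ := by
        rw [← ENNReal.ofReal_mul (by positivity)]
        apply ENNReal.ofReal_le_ofReal (le_of_eq _)
        rw [show 1 - θ = ε + ε by rw [hε]; ring, Real.rpow_add hM]
        ring

/-- For p = 1 the power t^(-θ) in the weak-type bound is no longer integrable at 0. Instead, the
weight is b itself, which is at least b(M) on (0,M). -/
lemma associate_one_indicator_lt_top {a₀ a₁ : ℝ} (h₀ : 0 ≤ a₀) (h₁ : a₁ ≤ 0) {M : ℝ} (hM : 0 < M) :
    associate halfLine (lzNorm 1 1 a₀ a₁) ((Iio M).indicator 1) < ∞ := by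
  have hbM := brokenLog_pos (a₀ := a₀) (a₁ := a₁) hM
  refine lt_of_le_of_lt (b := ENNReal.ofReal (brokenLog a₀ a₁ M)⁻¹) ?_ ENNReal.ofReal_lt_top
  refine iSup_le fun f => iSup_le fun hf => iSup_le fun hρ => ?_
  refine (lintegral_mul_indicator_le hf M).trans ?_
  have hm : Measurable fun t => weight 1 1 a₀ a₁ t * rearrangement halfLine f t :=
    (ENNReal.measurable_ofReal.comp ((measurable_id.pow_const _).mul
      (measurable_brokenLog a₀ a₁))).mul (measurable_rearrangement f)
  calc ∫⁻ t in Ioo 0 M, rearrangement halfLine f t ∂halfLine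
      ≤ ∫⁻ t in Ioo 0 M, ENNReal.ofReal (brokenLog a₀ a₁ M)⁻¹ *
          (weight 1 1 a₀ a₁ t * rearrangement halfLine f t) ∂halfLine := by
        refine setLIntegral_mono (hm.const_mul _) fun t ht => ?_
        have hb := brokenLog_antitoneOn h₀ h₁ ht.1 hM ht.2.le
        have : 1 ≤ ENNReal.ofReal (brokenLog a₀ a₁ M)⁻¹ * weight 1 1 a₀ a₁ t := by
          rw [weight, ← ENNReal.ofReal_mul (by positivity), ENNReal.one_le_ofReal]
          simp only [inv_one, ENNReal.toReal_one, sub_self, Real.rpow_zero, one_mul]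
          rw [inv_mul_eq_div, one_le_div hbM]
          exact hb
        rw [← mul_assoc]
        exact le_mul_of_one_le_left (zero_le) this
    _ ≤ ∫⁻ t, ENNReal.ofReal (brokenLog a₀ a₁ M)⁻¹ *
          (weight 1 1 a₀ a₁ t * rearrangement halfLine f t) ∂halfLine :=
        setLIntegral_le_lintegral _ _
    _ = ENNReal.ofReal (brokenLog a₀ a₁ M)⁻¹ * lzNorm 1 1 a₀ a₁ f := by
        rw [lintegral_const_mul' _ _ ENNReal.ofReal_ne_top, lzNorm, eLpNorm_one_eq_lintegral_enorm,
          inv_one, ENNReal.toReal_one]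
        simp only [weight, enorm_eq_self, inv_one, ENNReal.toReal_one]
    _ ≤ ENNReal.ofReal (brokenLog a₀ a₁ M)⁻¹ * 1 := by gcongr
    _ = _ := mul_one _

lemma not_boundedOn_of_lt {p q : ℝ≥0∞} (hq : 1 ≤ q) {a₀ a₁ α : ℝ}
    (hα₁ : α < 1) (hp : 1 - α < (p⁻¹).toReal)
    (hfin : associate halfLine (lzNorm p q a₀ a₁) ((Iio (2 * 1)).indicator 1) < ∞) :
    ¬ BoundedOn halfLine (associate halfLine (lzNorm p q a₀ a₁)) (supOperator α) := by
  intro hT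
  obtain ⟨C, hC⟩ := exists_lintegral_le_of_boundedOn hT
  obtain ⟨D, hD, hd⟩ := eLpNorm_indicator_weight_le hq
    (θ := (p⁻¹).toReal + α - 1) (by linarith) a₀ a₁
  have hd1 := hd 1 one_pos
  simp only [Real.one_rpow, mul_one, brokenLog_one] at hd1
  set A := associate halfLine (lzNorm p q a₀ a₁) ((Iio (2 * 1)).indicator 1)
  have key : ∀ δ, 0 < δ → δ < 1 - α → ENNReal.ofReal (1 / δ) ≤ ENNReal.ofReal D * (C * A) := by
    intro δ hδ hδ1
    set h : ℝ → ℝ≥0∞ := (Iio 1).indicator fun t => ENNReal.ofReal (t ^ (α - 1 + δ)) with hh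
    have hm : Measurable h := Measurable.indicator (by fun_prop) measurableSet_Iio
    have hanti : AntitoneOn h (Ioi 0) := by
      intro x hx y hy hxy
      by_cases hy1 : y < 1
      · rw [hh, indicator_of_mem (mem_Iio.2 hy1), indicator_of_mem (mem_Iio.2 (hxy.trans_lt hy1))]
        exact ENNReal.ofReal_le_ofReal (Real.rpow_le_rpow_of_nonpos hx hxy (by linarith))
      · simp [hh, hy1]
    -- The bound is uniform in δ: t^δ ≤ 1 on (0,1), and what remains is a weight of positive
    -- exponent θ + α - 1.
    have hle : eLpNorm (fun t => weight (p⁻¹).toReal q a₀ a₁ t * h t) q halfLine ≤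
        ENNReal.ofReal D := by
      refine le_trans (eLpNorm_mono_enorm_ae ?_) hd1
      filter_upwards [ae_halfLine_pos] with t ht
      simp only [enorm_eq_self]
      by_cases ht1 : t < 1
      · rw [hh, indicator_of_mem (mem_Iio.2 ht1), indicator_of_mem (mem_Ioo.2 ⟨ht, ht1⟩), weight,
          weight]
        have hb := brokenLog_pos (a₀ := a₀) (a₁ := a₁) ht
        rw [← ENNReal.ofReal_mul (by positivity)]
        apply ENNReal.ofReal_le_ofReal
        rw [mul_right_comm, ← Real.rpow_add ht]
        gcongr ?_ * _
        exact Real.rpow_le_rpow_of_exponent_ge ht ht1.le (by linarith)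
      · simp [hh, ht1]
    have := hC 1 one_pos hfin h D hm hanti hD hle
    refine le_trans (le_of_eq ?_) this
    have e : ∫⁻ t in Ioo 0 1, ENNReal.ofReal (t ^ (δ - 1)) ∂halfLine = ENNReal.ofReal (1 / δ) := by
      rw [lintegral_Ioo_rpow zero_le_one hδ, Real.one_rpow]
    rw [← e]
    refine setLIntegral_congr_fun measurableSet_Ioo fun t ht => ?_
    have ht0 := ht.1
    simp only [hh, indicator_of_mem (mem_Iio.2 ht.2), Real.one_rpow, ENNReal.ofReal_one, mul_one]
    rw [← ENNReal.ofReal_mul (by positivity), ← Real.rpow_add ht0]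
    congr 2; ring
  have hBtop : ENNReal.ofReal D * (C * A) ≠ ∞ :=
    ENNReal.mul_ne_top ENNReal.ofReal_ne_top (ENNReal.mul_ne_top ENNReal.coe_ne_top hfin.ne)
  set B := (ENNReal.ofReal D * (C * A)).toReal with hB
  have hB0 : 0 ≤ B := ENNReal.toReal_nonneg
  have hα' : 0 < 1 - α := by linarith
  set δ := min ((1 - α) / 2) (1 / (B + 1)) with hδ
  have hδ0 : 0 < δ := lt_min (by linarith) (by positivity)
  have h1 := key δ hδ0 ((min_le_left _ _).trans_lt (by linarith))
  rw [ENNReal.ofReal_le_iff_le_toReal hBtop, ← hB] at h1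
  have h2 : B + 1 ≤ 1 / δ := by
    rw [le_div_iff₀ hδ0]
    calc (B + 1) * δ ≤ (B + 1) * (1 / (B + 1)) := by gcongr; exact min_le_right _ _
      _ = 1 := by field_simp
  linarith

/-- The test condition at the critical exponent. -/
lemma exists_lintegral_le_of_boundedOn_of_eq {p q : ℝ≥0∞} (hq : 1 ≤ q) {a₀ a₁ α : ℝ}
    (hα : 0 < α) (hp : (p⁻¹).toReal = 1 - α)
    (hT : BoundedOn halfLine (associate halfLine (lzNorm p q a₀ a₁)) (supOperator α)) :
    ∃ C : ℝ, 0 < C ∧ ∀ N, 0 < N →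
      ∀ (h : ℝ → ℝ≥0∞) (K : ℝ), Measurable h → AntitoneOn h (Ioi 0) → 0 < K →
        eLpNorm (fun t => weight (1 - α) q a₀ a₁ t * h t) q halfLine ≤ ENNReal.ofReal K →
        ∫⁻ t in Ioo 0 N, h t * ENNReal.ofReal (t ^ (-α)) ∂halfLine ≤
          ENNReal.ofReal (C * K / brokenLog a₀ a₁ N) := by
  obtain ⟨C, hC⟩ := exists_lintegral_le_of_boundedOn hT
  obtain ⟨D, hD, hd⟩ := associate_indicator_le (p := p) hq a₀ a₁ (by rw [hp]; linarith)
  obtain ⟨E, hE, he⟩ := brokenLog_le_rpow a₀ a₁ one_pos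
  rw [hp] at hC
  rw [hp, sub_sub_cancel] at hd
  refine ⟨(C + 1) * (D * 2 ^ α * (E * 2)), by positivity, fun N hN h K hm hanti hK hle => ?_⟩
  have h2N : 0 < 2 * N := by linarith
  have hbN := brokenLog_pos (a₀ := a₀) (a₁ := a₁) hN
  have hb2N := brokenLog_pos (a₀ := a₀) (a₁ := a₁) h2N
  have hNα : 0 < N ^ α := by positivity
  have h1 := hC N hN ((hd (2 * N) h2N).trans_lt ENNReal.ofReal_lt_top) h K hm hanti hK hle
  have h2 : associate halfLine (lzNorm p q a₀ a₁) ((Iio (2 * N)).indicator 1) ≤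
      ENNReal.ofReal (D * 2 ^ α * (E * 2) * N ^ α / brokenLog a₀ a₁ N) := by
    refine (hd (2 * N) h2N).trans (ENNReal.ofReal_le_ofReal ?_)
    have h3 := (he N (2 * N) hN (by linarith)).2
    rw [mul_div_cancel_right₀ _ hN.ne', Real.rpow_one] at h3
    rw [div_le_div_iff₀ hb2N hbN, Real.mul_rpow two_pos.le hN.le]
    calc D * (2 ^ α * N ^ α) * brokenLog a₀ a₁ N
        ≤ D * (2 ^ α * N ^ α) * (E * 2 * brokenLog a₀ a₁ (2 * N)) := by gcongr
      _ = _ := by ring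
  have hNN : ENNReal.ofReal (N ^ α) * ENNReal.ofReal (N ^ α)⁻¹ = 1 := by
    rw [← ENNReal.ofReal_mul hNα.le, mul_inv_cancel₀ hNα.ne', ENNReal.ofReal_one]
  calc ∫⁻ t in Ioo 0 N, h t * ENNReal.ofReal (t ^ (-α)) ∂halfLine
      = ENNReal.ofReal (N ^ α)⁻¹ * ∫⁻ t in Ioo 0 N,
          h t * (ENNReal.ofReal (t ^ (-α)) * ENNReal.ofReal (N ^ α)) ∂halfLine := by
        rw [← lintegral_const_mul' _ _ ENNReal.ofReal_ne_top]
        refine lintegral_congr fun t => ?_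
        calc _ = (ENNReal.ofReal (N ^ α) * ENNReal.ofReal (N ^ α)⁻¹) *
              (h t * ENNReal.ofReal (t ^ (-α))) := by rw [hNN, one_mul]
          _ = _ := by ring
    _ ≤ ENNReal.ofReal (N ^ α)⁻¹ * (ENNReal.ofReal K * (ENNReal.ofReal (C + 1) *
          ENNReal.ofReal (D * 2 ^ α * (E * 2) * N ^ α / brokenLog a₀ a₁ N))) := by
        refine mul_le_mul_right (h1.trans (mul_le_mul_right (mul_le_mul' ?_ h2) _)) _
        rw [← ENNReal.ofReal_coe_nnreal]
        exact ENNReal.ofReal_le_ofReal (by linarith)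
    _ = _ := by
        rw [← ENNReal.ofReal_mul (by positivity), ← ENNReal.ofReal_mul (by positivity),
          ← ENNReal.ofReal_mul (by positivity)]
        congr 1
        field_simp

/-- Test with the characteristic function of (0,a): its norm is at most a constant times a^(1-α)
b(a), and the integral of t^(-α) over (0,a) is a^(1-α)/(1-α), so the powers of a cancel. -/
lemma exists_brokenLog_le_of_boundedOn {p q : ℝ≥0∞} (hq : 1 ≤ q) {a₀ a₁ α : ℝ}
    (hα : 0 < α) (hα₁ : α < 1) (hp : (p⁻¹).toReal = 1 - α)
    (hT : BoundedOn halfLine (associate halfLine (lzNorm p q a₀ a₁)) (supOperator α)) :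
    ∃ C : ℝ, 0 < C ∧ ∀ a N, 0 < a → a ≤ N → brokenLog a₀ a₁ N ≤ C * brokenLog a₀ a₁ a := by
  obtain ⟨C, hC, hH⟩ := exists_lintegral_le_of_boundedOn_of_eq hq hα hp hT
  have hα' : 0 < 1 - α := by linarith
  obtain ⟨D, hD, hd⟩ := eLpNorm_indicator_weight_le hq hα' a₀ a₁
  refine ⟨C * D * (1 - α), by positivity, fun a N ha haN => ?_⟩
  have hN := ha.trans_le haN
  have hbN := brokenLog_pos (a₀ := a₀) (a₁ := a₁) hN
  have hba := brokenLog_pos (a₀ := a₀) (a₁ := a₁) ha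
  have hanti : Antitone ((Iio a).indicator (1 : ℝ → ℝ≥0∞)) := by
    intro x y hxy
    by_cases hy : y < a
    · rw [indicator_of_mem (mem_Iio.2 hy), indicator_of_mem (mem_Iio.2 (hxy.trans_lt hy))]
      exact le_rfl
    · simp [hy]
  have hle : eLpNorm (fun t => weight (1 - α) q a₀ a₁ t * (Iio a).indicator 1 t) q halfLine ≤
      ENNReal.ofReal (D * a ^ (1 - α) * brokenLog a₀ a₁ a) := by
    refine le_trans (eLpNorm_mono_enorm_ae ?_) (hd a ha)
    filter_upwards [ae_halfLine_pos] with t ht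
    simp only [enorm_eq_self]
    by_cases hta : t < a
    · simp [indicator, hta, ht]
    · simp [hta]
  have h1 := hH N hN _ _ hanti.measurable (hanti.antitoneOn _) (by positivity) hle
  have h2 : ENNReal.ofReal (a ^ (1 - α) / (1 - α)) ≤
      ENNReal.ofReal (C * (D * a ^ (1 - α) * brokenLog a₀ a₁ a) / brokenLog a₀ a₁ N) := by
    refine le_trans ?_ h1
    rw [← lintegral_Ioo_rpow ha.le hα']
    refine le_trans (le_of_eq ?_) (lintegral_mono_set (Ioo_subset_Ioo_right haN))
    refine setLIntegral_congr_fun measurableSet_Ioo fun t ht => ?_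
    simp only [indicator_of_mem (mem_Iio.2 ht.2), Pi.one_apply, one_mul]
    congr 2; ring
  rw [ENNReal.ofReal_le_ofReal_iff (by positivity), div_le_div_iff₀ hα' hbN] at h2
  have haα : 0 < a ^ (1 - α) := by positivity
  refine le_of_mul_le_mul_left (h2.trans (le_of_eq ?_)) haα
  ring

/-- The pairs (exp(-x), 1) and (1, exp x) turn almost monotonicity of b into bounds on (1+x)^(-a₀)
and (1+x)^(a₁) for all x ≥ 0. -/
lemma nonneg_and_nonpos_of_boundedOn {p q : ℝ≥0∞} (hq : 1 ≤ q) {a₀ a₁ α : ℝ}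
    (hα : 0 < α) (hα₁ : α < 1) (hp : (p⁻¹).toReal = 1 - α)
    (hT : BoundedOn halfLine (associate halfLine (lzNorm p q a₀ a₁)) (supOperator α)) :
    0 ≤ a₀ ∧ a₁ ≤ 0 := by
  obtain ⟨C, hC, hH⟩ := exists_brokenLog_le_of_boundedOn hq hα hα₁ hp hT
  have key : ∀ b : ℝ, 0 < b → (∀ x, 0 ≤ x → (1 + x) ^ b ≤ C) → False := by
    intro b hb h
    have h1 := (tendsto_rpow_atTop hb).comp (Filter.tendsto_atTop_add_const_left _ (1 : ℝ)
      Filter.tendsto_id)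
    obtain ⟨x, hx, hx0⟩ := ((h1.eventually_gt_atTop C).and (Filter.eventually_ge_atTop 0)).exists
    exact absurd (h x hx0) (not_le.2 hx)
  constructor
  · by_contra hcon
    refine key (-a₀) (by linarith) fun x hx => ?_
    have h1 := hH (Real.exp (-x)) 1 (Real.exp_pos _) (Real.exp_le_one_iff.2 (by linarith))
    have h0 := le_max_left 0 (Real.log (Real.exp (-x)))
    rw [brokenLog_one, brokenLog_eq (Real.exp_pos _), Real.log_exp, neg_neg, max_eq_right hx,
      max_eq_left (by linarith), add_zero, Real.one_rpow, mul_one] at h1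
    rw [Real.rpow_neg (by positivity), inv_le_iff_one_le_mul₀ (by positivity)]
    exact h1
  · by_contra hcon
    refine key a₁ (by linarith) fun x hx => ?_
    have h1 := hH 1 (Real.exp x) one_pos (Real.one_le_exp hx)
    rw [brokenLog_one, brokenLog_eq (Real.exp_pos _), Real.log_exp, max_eq_left (by linarith),
      max_eq_right hx, add_zero, Real.one_rpow, mul_one, one_mul] at h1
    exact h1

/-! ### Necessity of q = 1 at the critical exponent -/

lemma lintegral_Ico_inv {a b : ℝ} (ha : 0 < a) (hab : a ≤ b) :
    ∫⁻ t in Ico a b, ENNReal.ofReal t⁻¹ ∂halfLine = ENNReal.ofReal (Real.log (b / a)) := by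
  have hr : halfLine.restrict (Ico a b) = volume.restrict (Ioc a b) := by
    rw [halfLine, Measure.restrict_restrict measurableSet_Ico,
      inter_eq_left.2 fun x hx => mem_Ioi.2 (ha.trans_le hx.1)]
    exact Measure.restrict_congr_set Ico_ae_eq_Ioc
  rw [hr, ← ofReal_integral_eq_lintegral_ofReal]
  · rw [← intervalIntegral.integral_of_le hab, integral_inv_of_pos ha (ha.trans_le hab)]
  · refine (intervalIntegrable_iff_integrableOn_Ioc_of_le hab).1
      (intervalIntegral.intervalIntegrable_inv (fun x hx => ?_) continuousOn_id)
    rw [uIcc_of_le hab] at hx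
    exact (ha.trans_le hx.1).ne'
  · filter_upwards [ae_restrict_mem measurableSet_Ioc] with t ht
    exact inv_nonneg.2 (ha.trans ht.1).le

lemma eLpNorm_indicator_Ico_rpow_le {q : ℝ≥0∞} (hq : 1 ≤ q) {a b : ℝ} (ha : 0 < a) (hab : a ≤ b) :
    eLpNorm ((Ico a b).indicator fun t => ENNReal.ofReal (t ^ (-(q⁻¹).toReal))) q halfLine ≤
      ENNReal.ofReal (Real.log (b / a) ^ (q⁻¹).toReal) := by
  rcases eq_or_ne q ∞ with rfl | hqt
  · rw [eLpNorm_exponent_top]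
    refine eLpNormEssSup_le_of_ae_enorm_bound (Filter.Eventually.of_forall fun t => ?_)
    rw [enorm_eq_self]
    by_cases h : t ∈ Ico a b
    · rw [indicator_of_mem h]; simp
    · simp [h]
  · have hq0 : q ≠ 0 := (zero_lt_one.trans_le hq).ne'
    have hqr : 0 < q.toReal := ENNReal.toReal_pos hq0 hqt
    rw [eLpNorm_indicator_eq_eLpNorm_restrict measurableSet_Ico,
      eLpNorm_eq_lintegral_rpow_enorm_toReal hq0 hqt, toReal_inv_eq]
    have : ∫⁻ t in Ico a b, ‖ENNReal.ofReal (t ^ (-(1 / q.toReal)))‖ₑ ^ q.toReal ∂halfLine =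
        ∫⁻ t in Ico a b, ENNReal.ofReal t⁻¹ ∂halfLine := by
      refine setLIntegral_congr_fun measurableSet_Ico fun t ht => ?_
      have ht0 := ha.trans_le ht.1
      simp only [enorm_eq_self]
      rw [ENNReal.ofReal_rpow_of_nonneg (Real.rpow_nonneg ht0.le _) hqr.le,
        ← Real.rpow_mul ht0.le, ← Real.rpow_neg_one]
      congr 2
      field_simp
    rw [this, lintegral_Ico_inv ha hab, ENNReal.ofReal_rpow_of_nonneg
      (Real.log_nonneg ((one_le_div ha).2 hab)) (by positivity)]

lemma brokenLog_exp_le {a₀ a₁ m t : ℝ} (hm : 0 < m) (ht₁ : Real.exp (-(2 * m)) ≤ t)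
    (ht₂ : t ≤ Real.exp (-m)) :
    brokenLog a₀ a₁ t ≤ 2 ^ |a₀| * brokenLog a₀ a₁ (Real.exp (-m)) := by
  have ht : 0 < t := (Real.exp_pos _).trans_le ht₁
  have h1 : -(2 * m) ≤ Real.log t := (Real.le_log_iff_exp_le ht).2 ht₁
  have h2 : Real.log t ≤ -m := (Real.log_le_iff_le_exp ht).2 ht₂
  rw [brokenLog_eq ht, brokenLog_eq (Real.exp_pos _), Real.log_exp, neg_neg,
    max_eq_right (by linarith : (0 : ℝ) ≤ -Real.log t), max_eq_left (by linarith : Real.log t ≤ 0),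
    max_eq_right hm.le, max_eq_left (by linarith : -m ≤ 0), add_zero, Real.one_rpow, mul_one,
    mul_one]
  exact rpow_le_mul_rpow (by linarith) (by linarith) one_le_two (by linarith) (by linarith) _

/-- Split at exp(-2m). The flat part contributes a multiple of b(exp(-2m)). On the rest the powers
combine to t^(-1/q), of norm m^(1/q). Between exp(-2m) and exp(-m) the logarithm at most doubles, so
b stays within a constant of b(exp(-m)). -/
lemma eLpNorm_weight_mul_truncated_rpow_le {q : ℝ≥0∞} (hq : 1 ≤ q) (a₀ a₁ : ℝ) {θ : ℝ}
    (hθ : 0 < θ) :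
    ∃ C : ℝ, 0 < C ∧ ∀ m, 0 < m →
      eLpNorm (fun t => weight θ q a₀ a₁ t * (Iio (Real.exp (-m))).indicator
        (fun t => ENNReal.ofReal (max t (Real.exp (-(2 * m))) ^ (-θ))) t) q halfLine ≤
      ENNReal.ofReal (C * (1 + m ^ (q⁻¹).toReal) * brokenLog a₀ a₁ (Real.exp (-m))) := by
  obtain ⟨D, hD, hd⟩ := eLpNorm_indicator_weight_le hq hθ a₀ a₁
  refine ⟨(D + 1) * 2 ^ |a₀|, by positivity, fun m hm => ?_⟩
  set a := Real.exp (-(2 * m)) with ha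
  set N := Real.exp (-m) with hN
  set σ := (q⁻¹).toReal with hσ
  have ha0 : 0 < a := Real.exp_pos _
  have hN0 : 0 < N := Real.exp_pos _
  have haN : a ≤ N := Real.exp_le_exp.2 (by linarith)
  have hba := brokenLog_pos (a₀ := a₀) (a₁ := a₁) ha0
  have hbN := brokenLog_pos (a₀ := a₀) (a₁ := a₁) hN0
  have hmσ : 0 < m ^ σ := by positivity
  have hlog : Real.log (N / a) = m := by
    rw [Real.log_div hN0.ne' ha0.ne', hN, ha, Real.log_exp, Real.log_exp]; ring
  have hwm : Measurable (weight θ q a₀ a₁) := ENNReal.measurable_ofReal.comp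
    ((measurable_id.pow_const _).mul (measurable_brokenLog a₀ a₁))
  set F₁ : ℝ → ℝ≥0∞ := fun t =>
    ENNReal.ofReal (a ^ (-θ)) * (Ioo 0 a).indicator (weight θ q a₀ a₁) t with hF₁
  set F₂ : ℝ → ℝ≥0∞ := fun t => ENNReal.ofReal (2 ^ |a₀| * brokenLog a₀ a₁ N) *
    (Ico a N).indicator (fun t => ENNReal.ofReal (t ^ (-σ))) t with hF₂
  have hF₁m : Measurable F₁ := (hwm.indicator measurableSet_Ioo).const_mul _
  have hF₂m : Measurable F₂ := (Measurable.indicator (by fun_prop) measurableSet_Ico).const_mul _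
  have hn₁ : eLpNorm F₁ q halfLine ≤ ENNReal.ofReal (D * (2 ^ |a₀| * brokenLog a₀ a₁ N)) := by
    refine (eLpNorm_le_ofReal_mul q (Filter.Eventually.of_forall fun t => le_rfl)).trans
      ((mul_le_mul_right (hd a ha0) _).trans ?_)
    rw [← ENNReal.ofReal_mul (by positivity)]
    apply ENNReal.ofReal_le_ofReal
    rw [Real.rpow_neg ha0.le]
    have haθ : 0 < a ^ θ := by positivity
    calc (a ^ θ)⁻¹ * (D * a ^ θ * brokenLog a₀ a₁ a) = D * brokenLog a₀ a₁ a := by field_simp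
      _ ≤ _ := by gcongr; exact brokenLog_exp_le hm le_rfl haN
  have hn₂ : eLpNorm F₂ q halfLine ≤ ENNReal.ofReal (2 ^ |a₀| * brokenLog a₀ a₁ N * m ^ σ) := by
    refine (eLpNorm_le_ofReal_mul q (Filter.Eventually.of_forall fun t => le_rfl)).trans
      ((mul_le_mul_right (eLpNorm_indicator_Ico_rpow_le hq ha0 haN) _).trans (le_of_eq ?_))
    rw [← ENNReal.ofReal_mul (by positivity), hlog]
  calc _ ≤ eLpNorm (F₁ + F₂) q halfLine := by
        apply eLpNorm_mono_enorm_ae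
        filter_upwards [ae_halfLine_pos] with t ht
        simp only [enorm_eq_self, Pi.add_apply]
        have hbt := brokenLog_pos (a₀ := a₀) (a₁ := a₁) ht
        by_cases htN : t < N
        · rw [indicator_of_mem (mem_Iio.2 htN)]
          rcases lt_or_ge t a with hta | hta
          · refine le_trans (le_of_eq ?_) le_self_add
            rw [hF₁, max_eq_right hta.le]
            simp only
            rw [indicator_of_mem (mem_Ioo.2 ⟨ht, hta⟩), mul_comm]
          · refine le_trans ?_ le_add_self
            rw [hF₂, max_eq_left hta]
            simp only
            rw [indicator_of_mem (mem_Ico.2 ⟨hta, htN⟩), weight, ← ENNReal.ofReal_mul (by positivity),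
              ← ENNReal.ofReal_mul (by positivity)]
            apply ENNReal.ofReal_le_ofReal
            rw [mul_right_comm, ← Real.rpow_add ht, mul_comm,
              show θ - (q⁻¹).toReal + -θ = -σ by rw [hσ]; ring]
            gcongr
            exact brokenLog_exp_le hm hta htN.le
        · rw [indicator_of_notMem (by simpa using htN)]
          simp
    _ ≤ eLpNorm F₁ q halfLine + eLpNorm F₂ q halfLine :=
        eLpNorm_add_le hF₁m.aestronglyMeasurable hF₂m.aestronglyMeasurable hq
    _ ≤ _ := by
        refine (add_le_add hn₁ hn₂).trans ?_
        rw [← ENNReal.ofReal_add (by positivity) (by positivity)]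
        apply ENNReal.ofReal_le_ofReal
        have h2 : 0 < (2 : ℝ) ^ |a₀| := by positivity
        have h3 : 0 ≤ 2 ^ |a₀| * brokenLog a₀ a₁ N * (1 + D * m ^ σ) := by positivity
        linarith [h3]

/-- For the truncated power h, the product h(t) t^(-α) equals 1/t on an interval of logarithmic
length m, while the norm of h grows only like m^(1/q). The factors b(N) cancel, and m → ∞ excludes q
> 1. -/
lemma eq_one_of_boundedOn {p q : ℝ≥0∞} (hq : 1 ≤ q) {a₀ a₁ α : ℝ}
    (hα : 0 < α) (hα₁ : α < 1) (hp : (p⁻¹).toReal = 1 - α)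
    (hT : BoundedOn halfLine (associate halfLine (lzNorm p q a₀ a₁)) (supOperator α)) :
    q = 1 := by
  by_contra hq1
  have hq1' : 1 < q := lt_of_le_of_ne hq (Ne.symm hq1)
  obtain ⟨C, hC, hH⟩ := exists_lintegral_le_of_boundedOn_of_eq hq hα hp hT
  obtain ⟨D, hD, hd⟩ := eLpNorm_weight_mul_truncated_rpow_le hq a₀ a₁
    (θ := 1 - α) (by linarith)
  set σ := (q⁻¹).toReal with hσ
  have hσ1 : σ < 1 := by
    rw [hσ, ← ENNReal.toReal_one]
    exact ENNReal.toReal_strict_mono ENNReal.one_ne_top (ENNReal.inv_lt_one.2 hq1')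
  have hσ0 : 0 ≤ σ := ENNReal.toReal_nonneg
  have key : ∀ m, 1 ≤ m → m ^ (1 - σ) ≤ C * D * 2 := by
    intro m hm1
    have hm : 0 < m := by linarith
    have hd := hd m hm
    set a := Real.exp (-(2 * m)) with ha
    set N := Real.exp (-m) with hN
    have ha0 : 0 < a := Real.exp_pos _
    have hN0 : 0 < N := Real.exp_pos _
    have haN : a ≤ N := Real.exp_le_exp.2 (by linarith)
    have hbN := brokenLog_pos (a₀ := a₀) (a₁ := a₁) hN0
    have hmσ : 0 < m ^ σ := by positivity
    have hlog : Real.log (N / a) = m := by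
      rw [Real.log_div hN0.ne' ha0.ne', hN, ha, Real.log_exp, Real.log_exp]; ring
    set h : ℝ → ℝ≥0∞ := (Iio N).indicator fun t => ENNReal.ofReal (max t a ^ (-(1 - α))) with hh
    have hmeas : Measurable h := Measurable.indicator (by fun_prop) measurableSet_Iio
    have hanti : AntitoneOn h (Ioi 0) := by
      intro x hx y hy hxy
      by_cases hyN : y < N
      · rw [hh, indicator_of_mem (mem_Iio.2 hyN), indicator_of_mem (mem_Iio.2 (hxy.trans_lt hyN))]
        exact ENNReal.ofReal_le_ofReal (Real.rpow_le_rpow_of_nonpos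
          (lt_max_of_lt_right ha0) (max_le_max_right a hxy) (by linarith))
      · simp [hh, hyN]
    have h1 := hH N hN0 h _ hmeas hanti (by positivity) hd
    have h2 : ENNReal.ofReal m ≤ ∫⁻ t in Ioo 0 N, h t * ENNReal.ofReal (t ^ (-α)) ∂halfLine := by
      rw [← hlog, ← lintegral_Ico_inv ha0 haN]
      refine le_trans (le_of_eq ?_) (lintegral_mono_set fun t (ht : t ∈ Ico a N) =>
        (mem_Ioo.2 ⟨ha0.trans_le ht.1, ht.2⟩))
      refine setLIntegral_congr_fun measurableSet_Ico fun t ht => ?_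
      have ht0 := ha0.trans_le ht.1
      simp only [hh, indicator_of_mem (mem_Iio.2 ht.2), max_eq_left ht.1]
      rw [← ENNReal.ofReal_mul (by positivity), ← Real.rpow_add ht0, ← Real.rpow_neg_one]
      congr 2; ring
    have h3 := h2.trans h1
    rw [ENNReal.ofReal_le_ofReal_iff (by positivity)] at h3
    have h4 : m ≤ C * D * 2 * m ^ σ := by
      have : 1 ≤ m ^ σ := Real.one_le_rpow hm1 hσ0
      calc m ≤ _ := h3
        _ = C * D * (1 + m ^ σ) := by field_simp
        _ ≤ C * D * (m ^ σ + m ^ σ) := by gcongr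
        _ = _ := by ring
    rw [Real.rpow_sub hm, Real.rpow_one, div_le_iff₀ hmσ]
    exact h4
  obtain ⟨m, hm, hm1⟩ := (((tendsto_rpow_atTop (by linarith : 0 < 1 - σ)).eventually_gt_atTop
    (C * D * 2)).and (Filter.eventually_ge_atTop 1)).exists
  exact absurd (key m hm1) (not_le.2 hm)

end LorentzZygmund
end

/-- Boundedness of `T_α` on the associate space of a Lorentz-Zygmund space. -/
theorem proposition5p4 (p q : ℝ≥0∞) (hp : 1 ≤ p) (hq : 1 ≤ q) (a₀ a₁ : ℝ)
    (hadm : LorentzZygmund.Admissible p q a₀ a₁)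
    (α : ℝ) (hα₀ : 0 < α) (hα₁ : α < 1) :
    LorentzZygmund.BoundedOn LorentzZygmund.halfLine
        (LorentzZygmund.associate LorentzZygmund.halfLine (LorentzZygmund.lzNorm p q a₀ a₁))
        (LorentzZygmund.supOperator α) ↔
      (p = ENNReal.ofReal (1 / (1 - α)) ∧ q = 1 ∧ 0 ≤ a₀ ∧ a₁ ≤ 0) ∨
        ENNReal.ofReal (1 / (1 - α)) < p := by
  have hα' : 0 < 1 - α := by linarith
  have hinv : (ENNReal.ofReal (1 / (1 - α)))⁻¹ = ENNReal.ofReal (1 - α) := by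
    rw [← ENNReal.ofReal_inv_of_pos (by positivity), one_div, inv_inv]
  have hptop : p⁻¹ ≠ ∞ := ENNReal.inv_ne_top.2 (zero_lt_one.trans_le hp).ne'
  have hlt : ENNReal.ofReal (1 / (1 - α)) < p ↔ (p⁻¹).toReal < 1 - α := by
    rw [← ENNReal.inv_lt_inv, hinv, ENNReal.lt_ofReal_iff_toReal_lt hptop]
  have heq : p = ENNReal.ofReal (1 / (1 - α)) ↔ (p⁻¹).toReal = 1 - α := by
    rw [← inv_inj, hinv]
    constructor
    · intro h
      rw [h, ENNReal.toReal_ofReal hα'.le]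
    · intro h
      rw [← h, ENNReal.ofReal_toReal hptop]
  rw [hlt, heq]
  constructor
  · intro hT
    rcases lt_trichotomy (p⁻¹).toReal (1 - α) with h | h | h
    · exact Or.inr h
    · obtain ⟨h0, h1⟩ := LorentzZygmund.nonneg_and_nonpos_of_boundedOn hq hα₀ hα₁ h hT
      exact Or.inl ⟨h, LorentzZygmund.eq_one_of_boundedOn hq hα₀ hα₁ h hT, h0, h1⟩
    · refine absurd hT (LorentzZygmund.not_boundedOn_of_lt hq hα₁ h ?_)
      have hpinf : p ≠ ∞ := by
        rintro rfl
        simp only [ENNReal.inv_top, ENNReal.toReal_zero] at h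
        linarith
      -- Admissibility enters only here: the test function must have finite associate norm for
      -- boundedness to say anything.
      rcases hadm with ⟨rfl, rfl, h0, h1⟩ | ⟨hp1, -⟩ | ⟨rfl, -⟩ | ⟨rfl, -⟩
      · exact LorentzZygmund.associate_one_indicator_lt_top h0 h1 (by norm_num)
      · obtain ⟨C, -, hC⟩ := LorentzZygmund.associate_indicator_le (p := p) hq a₀ a₁ (by
          rw [← ENNReal.toReal_one]
          exact ENNReal.toReal_strict_mono ENNReal.one_ne_top (ENNReal.inv_lt_one.2 hp1))
        exact (hC _ (by norm_num)).trans_lt ENNReal.ofReal_lt_top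
      · exact absurd rfl hpinf
      · exact absurd rfl hpinf
  · rintro (⟨h, rfl, h0, h1⟩ | h)
    · obtain ⟨C, hC⟩ := LorentzZygmund.exists_associate_supFun_le_of_eq hα₀ hα₁ h h0 h1
      exact LorentzZygmund.boundedOn_supOperator α _ C hC
    · obtain ⟨C, hC⟩ := LorentzZygmund.exists_associate_supFun_le_of_lt (p := p) q a₀ a₁ hα₀
        (by linarith)
      exact LorentzZygmund.boundedOn_supOperator α _ C hC
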